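/- **Model.** Let $I=\{c,g\}$ (coal, gas); for $i\in I$ let $j$ denote the other fuel. Let $k_i\in\mathbb R$, $m_i>0$, $\bar\xi^i>0$, $\bar\xi=\bar\xi^c+\bar\xi^g$, and let $b_i(\xi,s)=s\exp(k_i+m_i\xi)$ be the bid curve of fuel $i$, with generalized inverse $\hat b_i^{-1}(p,s)=\bar\xi^i\wedge\inf\{\xi\in(0,\bar\xi^i]: b_i(\xi,s)>p\}$ ($\inf\emptyset=+\infty$). The market bid stack is $$b(\xi,\mathbf s)=\min_{i\in I}b_i(0,s^i)\ \vee\ \sup\Big\{p\in\mathbb R:\sum_{i\in I}\hat b_i^{-1}(p,s^i)<\xi\Big\}\qquad(\sup\emptyset=-\infty).$$ Let $\mathbb Q$ be the pricing probability measure, $(\mathcal F_t)$ a filtration, $0\le t\le T$, $r\in\mathbb R$, let $S^c_T,S^g_T>0$ a.s. be the integrable fuel prices at maturity, $F^i_t=\mathbb E^{\mathbb Q}[S^i_T\mid\mathcal F_t]$ the fuel forward prices, $\mathbf F_t=(F^c_t,F^g_t)$, and let $X_T$ be a real random variable. Demand at maturity is $D_T=\max(0,\min(\bar\xi,X_T))$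 and the electricity spot price is $P_T=b(D_T,\mathbf S_T)$. Assume that, under $\mathbb Q$ and conditionally on $\mathcal F_t$ (for trivial $\mathcal F_t$, e.g. at $t=0$, simply under $\mathbb Q$), * $(\log S^c_T,\log S^g_T)$ is bivariate Gaussian with $\mathcal F_t$-measurable means $\mu_c,\mu_g$, constant variances $\sigma_c^2,\sigma_g^2$ and correlation $\rho\in[-1,1]$ ($\sigma_c,\sigma_g\ge0$), where $\sigma^2:=\sigma_c^2-2\rho\sigma_c\sigma_g+\sigma_g^2>0$; * $X_T\sim N(\mu_d,\sigma_d^2)$ with $\mu_d$ $\mathcal F_t$-measurable and $\sigma_d>0$ constant; * $X_T$ is independent of $\mathbf S_T=(S^c_T,S^g_T)$. Let the heat rate satisfy $\exp(k_c)\le h_c\le\exp(k_c+m_c\bar\xi^c)$, and let $V_t=e^{-r(T-t)}\mathbb E^{\mathbb Q}[(P_T-h_cS^c_T)^+\mid\mathcal F_t]$ be the dark spread option price. **Notation.** $\Phi_1$ is the standard normal cdf, $\Phi_2(\cdot,\cdot;\varrho)$ the standard bivariate normal cdf with correlation $\varrho$, and for a $2\times n$ matrix $x$ and $q\in\mathbb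 R$ put $$\Phi_2^{2\times n}(x-q,y;\varrho)=\sum_{l=1}^n\big[\Phi_2(x_{1l}-q,y;\varrho)-\Phi_2(x_{2l}-q,y;\varrho)\big]$$ ($q$ is subtracted from every entry). Let $\alpha_c=\frac{m_g}{m_c+m_g}$, $\alpha_g=\frac{m_c}{m_c+m_g}$, $\beta=\frac{k_cm_g+k_gm_c}{m_c+m_g}$, $\gamma=\frac{m_cm_g}{m_c+m_g}$, $b_{cg}(\xi,\mathbf s)=(s^c)^{\alpha_c}(s^g)^{\alpha_g}e^{\beta+\gamma\xi}$, $\xi^h=(\log h_c-k_c)/m_c$, $\bar\xi^{i_-}=\bar\xi^c\wedge\bar\xi^g$, $\bar\xi^{i_+}=\bar\xi^c\vee\bar\xi^g$, $$(a_1,\dots,a_8)=\tfrac1{\sigma_d}\big[(0,\ \bar\xi^g\wedge\xi^h,\ \bar\xi^{i_-},\ \bar\xi^{i_-}\vee\xi^h,\ \bar\xi^{i_+}\wedge(\bar\xi^g+\xi^h),\ \bar\xi^{i_+},\ \bar\xi^c\vee(\bar\xi^g+\xi^h),\ \bar\xi)-\mu_d\big],\qquad a_*=\tfrac{\bar\xi^c-\mu_d}{\sigma_d},$$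 $$R_i(\xi,\xi')=k_j+m_j\xi'-k_i-m_i\xi+\log F^j_t-\log F^i_t-\tfrac12\sigma^2,\qquad \tilde R_i(z)=z+\log F^j_t-\log F^i_t-\tfrac12\sigma^2,$$ $$\sigma_{i,d}^2=m_i^2\sigma_d^2+\sigma^2,\quad \sigma_{g,\gamma}^2=\gamma^2\sigma_d^2/\alpha_g^2+\sigma^2,\quad \eta=\tfrac12(\gamma^2\sigma_d^2-\alpha_c\alpha_g\sigma^2),\quad z_*=(\beta+\gamma\mu_d-\log h_c)/\alpha_g.$$ **Conclusion.** $(P_T-h_cS_T^c)^+$ is $\mathbb Q$-integrable and, $\mathbb Q$-almost surely, $$\begin{aligned} V_t=e^{-r(T-t)}\Big\{&b_c(\mu_d,F^c_t)\,e^{m_c^2\sigma_d^2/2}\,\Phi_2^{2\times2}\Big(\begin{bmatrix}a_*&a_3\\a_4&a_2\end{bmatrix}-m_c\sigma_d,\tfrac{R_c(\mu_d,0)-m_c^2\sigma_d^2}{\sigma_{c,d}};\tfrac{m_c\sigma_d}{\sigma_{c,d}}\Big)\\ &+b_c(\mu_d-\bar\xi^g,F^c_t)\,e^{m_c^2\sigma_d^2/2}\,\Phi_2^{2\times2}\Big(\begin{bmatrix}a_8&a_6\\a_7&a_5\end{bmatrix}-m_c\sigma_d,\tfrac{-R_c(\mu_d-\bar\xi^g,\bar\xi^g)+m_c^2\sigma_d^2}{\sigma_{c,d}};\tfrac{-m_c\sigma_d}{\sigma_{c,d}}\Big)\\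 &+b_g(\mu_d-\bar\xi^c,F^g_t)\,e^{m_g^2\sigma_d^2/2}\,\Phi_2^{2\times1}\Big(\begin{bmatrix}a_8\\a_*\end{bmatrix}-m_g\sigma_d,\tfrac{-R_g(\mu_d-\bar\xi^c,\bar\xi^c)+m_g^2\sigma_d^2}{\sigma_{g,d}};\tfrac{-m_g\sigma_d}{\sigma_{g,d}}\Big)\\ &-h_cF^c_t\,\Phi_2^{2\times3}\Big(\begin{bmatrix}a_7&a_5&a_3\\a_6&a_4&a_2\end{bmatrix},\tfrac{\tilde R_c(z_*)}{\sigma_{g,\gamma}};\tfrac{-\gamma\sigma_d}{\alpha_g\sigma_{g,\gamma}}\Big)\\ &+b_{cg}(\mu_d,\mathbf F_t)\,e^{\eta}\Big[\Phi_2^{2\times2}\Big(\begin{bmatrix}a_*&a_3\\a_4&a_2\end{bmatrix}-\gamma\sigma_d,\tfrac{-R_c(\mu_d,0)-\alpha_g\sigma^2+\gamma m_c\sigma_d^2}{\sigma_{c,d}};\tfrac{-m_c\sigma_d}{\sigma_{c,d}}\Big)\\ &\qquad-\Phi_2^{2\times2}\Big(\begin{bmatrix}a_8&a_6\\a_7&a_5\end{bmatrix}-\gamma\sigma_d,\tfrac{-R_c(\mu_d-\bar\xi^g,\bar\xi^g)-\alpha_g\sigma^2+\gamma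 m_c\sigma_d^2}{\sigma_{c,d}};\tfrac{-m_c\sigma_d}{\sigma_{c,d}}\Big)\\ &\qquad+\Phi_2^{2\times1}\Big(\begin{bmatrix}a_8\\a_*\end{bmatrix}-\gamma\sigma_d,\tfrac{R_g(\mu_d-\bar\xi^c,\bar\xi^c)+\alpha_c\sigma^2-\gamma m_g\sigma_d^2}{\sigma_{g,d}};\tfrac{m_g\sigma_d}{\sigma_{g,d}}\Big)\\ &\qquad-\Phi_2^{2\times3}\Big(\begin{bmatrix}a_7&a_5&a_3\\a_6&a_4&a_2\end{bmatrix}-\gamma\sigma_d,\tfrac{-\tilde R_c(z_*)-\alpha_g\sigma^2-\gamma^2\sigma_d^2/\alpha_g}{\sigma_{g,\gamma}};\tfrac{\gamma\sigma_d}{\alpha_g\sigma_{g,\gamma}}\Big)\Big]\\ &+\Phi_1(-a_8)\sum_{i\in I}b_i(\bar\xi^i,F^i_t)\,\Phi_1\Big(\tfrac{-R_i(\bar\xi^i,\bar\xi^j)}{\sigma}\Big)-h_cF^c_t\big(1-\Phi_1(a_7)+\Phi_1(a_6)-\Phi_1(a_5)\big)\Big\}. \end{aligned}$$ -/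

import Mathlib

open MeasureTheory ProbabilityTheory
open scoped NNReal

noncomputable section

namespace DarkSpread

/-! ### The bid stack -/

/-- The index set `I = {c, g}` of the two fuels, coal and natural gas. -/
inductive Fuel
  | c
  | g
  deriving DecidableEq

instance : Fintype Fuel := ⟨{Fuel.c, Fuel.g}, fun i => by cases i <;> simp⟩

/-- The fuel `j` with `I = {i, j}`. -/
def Fuel.other : Fuel → Fuel
  | .c => .g
  | .g => .c

/-- Parameters of the two exponential fuel bid curves: `k i`, the slopes `m i > 0`, and the
aggregate capacities `cap i > 0` of the generators that use fuel `i`. -/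
structure BidCurves where
  k : Fuel → ℝ
  m : Fuel → ℝ
  cap : Fuel → ℝ
  m_pos : ∀ i, 0 < m i
  cap_pos : ∀ i, 0 < cap i

namespace BidCurves

variable (B : BidCurves)

/-- Market capacity. -/
def totalCap : ℝ := ∑ i, B.cap i

/-- The fuel bid curve `b_i(ξ, s) = s exp(k_i + m_i ξ)`. -/
def bid (i : Fuel) (ξ s : ℝ) : ℝ := s * Real.exp (B.k i + B.m i * ξ)

/-- The generalized right continuous inverse of `ξ ↦ b_i(ξ, s)` on `[0, cap i]`, that is
`cap i ∧ inf {ξ ∈ (0, cap i] : b_i(ξ, s) > p}` with `inf ∅ = +∞`; the minimum with `cap i` is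
taken by adding `cap i` to the set, so that the infimum is over a nonempty bounded set. -/
def bidInv (i : Fuel) (p s : ℝ) : ℝ :=
  sInf (insert (B.cap i) {ξ : ℝ | ξ ∈ Set.Ioc 0 (B.cap i) ∧ p < B.bid i ξ s})

/-- The market bid stack given by the merit order,
`b(ξ, s) = min_i b_i(0, s_i) ∨ sup {p : ∑ i, b_i(·, s_i)⁻¹(p) < ξ}` with `sup ∅ = -∞`; the
maximum is taken by adding the first term to the set, which makes the set nonempty. -/
def stack (ξ : ℝ) (s : Fuel → ℝ) : ℝ :=
  sSup (insert (min (B.bid .c 0 (s .c)) (B.bid .g 0 (s .g)))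
    {p : ℝ | ∑ i, B.bidInv i p (s i) < ξ})

/-- Demand, truncated at zero and at market capacity. -/
def demand (x : ℝ) : ℝ := max 0 (min B.totalCap x)

/-- Payoff of the dark spread option with heat rate `h`, for fuel prices `s` and untruncated
demand `x` at maturity. -/
def payoff (h : ℝ) (s : Fuel → ℝ) (x : ℝ) : ℝ := max (B.stack (B.demand x) s - h * s .c) 0

def alpha (i : Fuel) : ℝ := B.m i.other / (B.m .c + B.m .g)

def beta : ℝ := (B.k .c * B.m .g + B.k .g * B.m .c) / (B.m .c + B.m .g)

def gamma : ℝ := B.m .c * B.m .g / (B.m .c + B.m .g)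

/-- `b_cg(ξ, s) = s_c ^ α_c * s_g ^ α_g * exp(β + γ ξ)`. -/
def bidBoth (ξ : ℝ) (s : Fuel → ℝ) : ℝ :=
  s .c ^ B.alpha .c * s .g ^ B.alpha .g * Real.exp (B.beta + B.gamma * ξ)

end BidCurves

/-! ### Conditional laws, forward prices and option prices -/

section Pricing

variable {Ω : Type*} {mΩ : MeasurableSpace Ω}

/-- Given the sub-σ-algebra `m`, the random element `Y` has the (regular) conditional law `κ ω`
under `Q`. -/
def HasCondLaw {E : Type*} [MeasurableSpace E] (Q : Measure Ω) (m : MeasurableSpace Ω)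
    (Y : Ω → E) (κ : Ω → Measure E) : Prop :=
  ∀ A : Set E, MeasurableSet A → Q⟦Y ⁻¹' A | m⟧ =ᵐ[Q] fun ω => (κ ω).real A

/-- `Y` and `Z` are independent under `Q` conditionally on `m`. -/
def CondIndependent {E F : Type*} [MeasurableSpace E] [MeasurableSpace F] (Q : Measure Ω)
    (m : MeasurableSpace Ω) (Y : Ω → E) (Z : Ω → F) : Prop :=
  ∀ A : Set E, ∀ A' : Set F, MeasurableSet A → MeasurableSet A' →
    Q⟦Y ⁻¹' A ∩ Z ⁻¹' A' | m⟧ =ᵐ[Q] fun ω => (Q⟦Y ⁻¹' A | m⟧) ω * (Q⟦Z ⁻¹' A' | m⟧) ω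

/-- Forward price of the fuel with price `S` at maturity, given the information `m`. -/
def forwardPrice (Q : Measure Ω) (m : MeasurableSpace Ω) (S : Ω → ℝ) : Ω → ℝ := Q[S | m]

/-- The covariance matrix of the log fuel prices. -/
def logCov (σ : Fuel → ℝ) (ρ : ℝ) : Matrix Fuel Fuel ℝ :=
  Matrix.of fun i j => if i = j then σ i ^ 2 else ρ * σ i * σ j

/-- The bivariate Gaussian law of the log fuel prices. -/
def logLaw (μ : Fuel → ℝ) (σ : Fuel → ℝ) (ρ : ℝ) : Measure (EuclideanSpace ℝ Fuel) :=
  multivariateGaussian (WithLp.toLp 2 μ) (logCov σ ρ)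

/-- The price at time `t` of the dark spread option with maturity `T`: the discounted
conditional expectation of the payoff under the pricing measure `Q`. -/
def spreadPrice (Q : Measure Ω) (ℱ : Filtration ℝ≥0 mΩ) (r : ℝ) (t T : ℝ≥0) (B : BidCurves)
    (h : ℝ) (S : Fuel → Ω → ℝ) (X : Ω → ℝ) : Ω → ℝ := fun ω =>
  Real.exp (-r * ((T : ℝ) - t)) * (Q[fun ω' => B.payoff h (fun i => S i ω') (X ω') | ℱ t]) ω

end Pricing

/-! ### The closed formula -/

/-- The standard univariate Gaussian cdf. -/
def Phi1 (x : ℝ) : ℝ := cdf (gaussianReal 0 1) x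

/-- The standard bivariate Gaussian cdf with correlation `ρ`. -/
def Phi2 (x y ρ : ℝ) : ℝ :=
  (multivariateGaussian (0 : EuclideanSpace ℝ (Fin 2)) !![1, ρ; ρ, 1]).real
    {z | z 0 ≤ x ∧ z 1 ≤ y}

/-- `Φ_2^{2 × n}(x, y; ρ) = ∑ i, (Φ_2(x_{1i}, y; ρ) - Φ_2(x_{2i}, y; ρ))`. -/
def Phi2n {n : ℕ} (x : Matrix (Fin 2) (Fin n) ℝ) (y ρ : ℝ) : ℝ :=
  ∑ i, (Phi2 (x 0 i) y ρ - Phi2 (x 1 i) y ρ)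

/-- Subtract `q` from every entry of a matrix. -/
def shift {n : ℕ} (q : ℝ) (x : Matrix (Fin 2) (Fin n) ℝ) : Matrix (Fin 2) (Fin n) ℝ :=
  Matrix.of fun i j => x i j - q

/-- `σ² = σ_c² - 2 ρ σ_c σ_g + σ_g²`. -/
def volSq (σ : Fuel → ℝ) (ρ : ℝ) : ℝ := σ .c ^ 2 - 2 * ρ * σ .c * σ .g + σ .g ^ 2

namespace BidCurves

variable (B : BidCurves)

/-- `ξ^h = (log h - k_c) / m_c`. -/
def xiH (h : ℝ) : ℝ := (Real.log h - B.k .c) / B.m .c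

/-- The demand levels at which the form of the option price changes, in increasing order. -/
def level (h : ℝ) : Fin 8 → ℝ :=
  ![0,
    min (B.cap .g) (B.xiH h),
    min (B.cap .c) (B.cap .g),
    max (min (B.cap .c) (B.cap .g)) (B.xiH h),
    min (max (B.cap .c) (B.cap .g)) (B.cap .g + B.xiH h),
    max (B.cap .c) (B.cap .g),
    max (B.cap .c) (B.cap .g + B.xiH h),
    B.totalCap]

/-- `R_i(ξ, ξ')`, for the squared volatility `v` and the forward prices `F`. -/
def R (v : ℝ) (F : Fuel → ℝ) (i : Fuel) (ξ ξ' : ℝ) : ℝ :=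
  B.k i.other + B.m i.other * ξ' - B.k i - B.m i * ξ + Real.log (F i.other) - Real.log (F i)
    - v / 2

/-- `R̃_i(z)`, for the squared volatility `v` and the forward prices `F`. -/
def Rt (v : ℝ) (F : Fuel → ℝ) (i : Fuel) (z : ℝ) : ℝ :=
  z + Real.log (F i.other) - Real.log (F i) - v / 2

/-- The undiscounted dark spread price as an explicit function of the fuel forward prices `F`. -/
def closedForm (h : ℝ) (σ : Fuel → ℝ) (ρ μd σd : ℝ) (F : Fuel → ℝ) : ℝ :=
  let v := volSq σ ρ
  let s := Real.sqrt v
  let a₂ := (B.level h 1 - μd) / σd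
  let a₃ := (B.level h 2 - μd) / σd
  let a₄ := (B.level h 3 - μd) / σd
  let a₅ := (B.level h 4 - μd) / σd
  let a₆ := (B.level h 5 - μd) / σd
  let a₇ := (B.level h 6 - μd) / σd
  let a₈ := (B.level h 7 - μd) / σd
  let aC := (B.cap .c - μd) / σd
  let mc := B.m .c
  let mg := B.m .g
  let ξc := B.cap .c
  let ξg := B.cap .g
  let γ := B.gamma
  let αc := B.alpha .c
  let αg := B.alpha .g
  let σcd := Real.sqrt (mc ^ 2 * σd ^ 2 + v)
  let σgd := Real.sqrt (mg ^ 2 * σd ^ 2 + v)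
  let σgγ := Real.sqrt (γ ^ 2 * σd ^ 2 / αg ^ 2 + v)
  let η := (γ ^ 2 * σd ^ 2 - αc * αg * v) / 2
  let z := (B.beta + γ * μd - Real.log h) / αg
  B.bid .c μd (F .c) * Real.exp (mc ^ 2 * σd ^ 2 / 2)
      * Phi2n (shift (mc * σd) !![aC, a₃; a₄, a₂])
          ((B.R v F .c μd 0 - mc ^ 2 * σd ^ 2) / σcd) (mc * σd / σcd)
    + B.bid .c (μd - ξg) (F .c) * Real.exp (mc ^ 2 * σd ^ 2 / 2)
      * Phi2n (shift (mc * σd) !![a₈, a₆; a₇, a₅])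
          ((-B.R v F .c (μd - ξg) ξg + mc ^ 2 * σd ^ 2) / σcd) (-(mc * σd) / σcd)
    + B.bid .g (μd - ξc) (F .g) * Real.exp (mg ^ 2 * σd ^ 2 / 2)
      * Phi2n (shift (mg * σd) !![a₈; aC])
          ((-B.R v F .g (μd - ξc) ξc + mg ^ 2 * σd ^ 2) / σgd) (-(mg * σd) / σgd)
    - h * F .c
      * Phi2n !![a₇, a₅, a₃; a₆, a₄, a₂]
          (Rt v F .c z / σgγ) (-(γ * σd) / (αg * σgγ))
    + B.bidBoth μd F * Real.exp η
      * (Phi2n (shift (γ * σd) !![aC, a₃; a₄, a₂])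
            ((-B.R v F .c μd 0 - αg * v + γ * mc * σd ^ 2) / σcd) (-(mc * σd) / σcd)
          - Phi2n (shift (γ * σd) !![a₈, a₆; a₇, a₅])
            ((-B.R v F .c (μd - ξg) ξg - αg * v + γ * mc * σd ^ 2) / σcd) (-(mc * σd) / σcd)
          + Phi2n (shift (γ * σd) !![a₈; aC])
            ((B.R v F .g (μd - ξc) ξc + αc * v - γ * mg * σd ^ 2) / σgd) (mg * σd / σgd)
          - Phi2n (shift (γ * σd) !![a₇, a₅, a₃; a₆, a₄, a₂])
            ((-Rt v F .c z - αg * v - γ ^ 2 * σd ^ 2 / αg) / σgγ) (γ * σd / (αg * σgγ)))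
    + Phi1 (-a₈)
      * ∑ i : Fuel, B.bid i (B.cap i) (F i)
          * Phi1 (-B.R v F i (B.cap i) (B.cap i.other) / s)
    - h * F .c * (1 - Phi1 a₇ + Phi1 a₆ - Phi1 a₅)

end BidCurves

end DarkSpread

end

noncomputable section

namespace DarkSpread

section GaussianTilt

theorem integrable_exp_of_integral_eq {Z : Type*} {mZ : MeasurableSpace Z} {G : Measure Z}
    {f : Z → ℝ} {a : ℝ} (h : ∫ z, Real.exp (f z) ∂G = Real.exp a) :
    Integrable (fun z => Real.exp (f z)) G := by
  by_contra hf
  rw [integral_undef hf] at h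
  exact (Real.exp_pos a).ne h

theorem eq_gaussianReal_of_mgf (ν : Measure ℝ) [IsProbabilityMeasure ν] (m : ℝ) (v : ℝ≥0)
    (h : ∀ s, ∫ x, Real.exp (s * x) ∂ν = Real.exp (s * m + s ^ 2 * v / 2)) :
    ν = gaussianReal m v := by
  have hmgf : mgf id ν = mgf id (gaussianReal m v) := by
    rw [mgf_id_gaussianReal]
    ext s
    rw [mgf]
    refine (h s).trans ?_
    congr 1
    ring
  have hset : integrableExpSet id ν = Set.univ := by
    ext s
    simpa [integrableExpSet] using integrable_exp_of_integral_eq (h s)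
  refine Measure.ext_of_complexMGF_id_eq (funext fun z => ?_)
  exact eqOn_complexMGF_of_mgf hmgf (by simp [hset])

variable {Z : Type*} {mZ : MeasurableSpace Z} {G : Measure Z}

theorem integral_exp_mul_indicator_eq {ℓ : Z → ℝ} {a : ℝ}
    (h : ∫ z, Real.exp (ℓ z) ∂G = Real.exp a) {A : Set Z} (hA : MeasurableSet A) :
    ∫ z, Real.exp (ℓ z) * A.indicator 1 z ∂G = Real.exp a * (G.tilted ℓ).real A := by
  have hi : ∀ z, Real.exp (ℓ z) * A.indicator 1 z = A.indicator (fun z => Real.exp (ℓ z)) z := by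
    intro z
    by_cases hz : z ∈ A <;> simp [hz]
  simp_rw [hi]
  rw [integral_indicator hA, measureReal_def, tilted_apply_eq_ofReal_integral' _ hA,
    ENNReal.toReal_ofReal (integral_nonneg fun z => by positivity), integral_div, h]
  field_simp

variable [IsProbabilityMeasure G]

theorem map_tilted_eq_gaussianReal {ℓ f : Z → ℝ} (hf : Measurable f) {a m v : ℝ}
    (hv : 0 ≤ v) (h : ∀ s : ℝ, ∫ z, Real.exp (ℓ z + s * f z) ∂G = Real.exp (a + s * m + s ^ 2 * v / 2)) :
    (G.tilted ℓ).map f = gaussianReal m v.toNNReal := by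
  have h0 : ∫ z, Real.exp (ℓ z) ∂G = Real.exp a := by simpa using h 0
  have hp := isProbabilityMeasure_tilted (integrable_exp_of_integral_eq h0)
  have := Measure.isProbabilityMeasure_map (μ := G.tilted ℓ) hf.aemeasurable
  refine eq_gaussianReal_of_mgf _ _ _ fun s => ?_
  rw [integral_map hf.aemeasurable (by fun_prop), integral_exp_tilted, h0]
  simp only [Pi.add_apply]
  rw [h s, ← Real.exp_sub, Real.coe_toNNReal v hv]
  congr 1
  ring

theorem posSemidef_correlation {r : ℝ} (hr : r ^ 2 ≤ 1) :
    (!![1, r; r, 1] : Matrix (Fin 2) (Fin 2) ℝ).PosSemidef := by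
  refine Matrix.PosSemidef.of_dotProduct_mulVec_nonneg ?_ fun x => ?_
  · ext i j
    fin_cases i <;> fin_cases j <;> simp
  · simp only [Matrix.mulVec, dotProduct, Fin.sum_univ_two, star_trivial, Matrix.of_apply,
      Matrix.cons_val', Matrix.cons_val_zero, Matrix.cons_val_one, Matrix.cons_val_fin_one]
    nlinarith [sq_nonneg (x 0 + r * x 1), sq_nonneg (x 1), mul_nonneg (sub_nonneg.2 hr) (sq_nonneg (x 1))]

variable {ℓ f g : Z → ℝ} {a m₁ m₂ v₁ v₂ c : ℝ}

theorem map_tilted_eq_multivariateGaussian (hf : Measurable f) (hg : Measurable g)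
    (hv₁ : 0 < v₁) (hv₂ : 0 < v₂) (hc : c ^ 2 ≤ v₁ * v₂)
    (h : ∀ s t : ℝ, ∫ z, Real.exp (ℓ z + s * f z + t * g z) ∂G
      = Real.exp (a + s * m₁ + t * m₂ + (s ^ 2 * v₁ + 2 * s * t * c + t ^ 2 * v₂) / 2)) :
    (G.tilted ℓ).map
        (fun z => (WithLp.toLp 2 ![(f z - m₁) / √v₁, (g z - m₂) / √v₂] : EuclideanSpace ℝ (Fin 2)))
      = multivariateGaussian 0 !![1, c / (√v₁ * √v₂); c / (√v₁ * √v₂), 1] := by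
  have h0 : ∫ z, Real.exp (ℓ z) ∂G = Real.exp a := by simpa using h 0 0
  have hp := isProbabilityMeasure_tilted (integrable_exp_of_integral_eq h0)
  have hm : Measurable fun z =>
      (WithLp.toLp 2 ![(f z - m₁) / √v₁, (g z - m₂) / √v₂] : EuclideanSpace ℝ (Fin 2)) := by
    refine (WithLp.measurable_toLp 2 _).comp (measurable_pi_lambda _ fun i => ?_)
    fin_cases i <;> simp <;> fun_prop
  have := Measure.isProbabilityMeasure_map (μ := G.tilted ℓ) hm.aemeasurable
  have e₁ : √v₁ ^ 2 = v₁ := Real.sq_sqrt hv₁.le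
  have e₂ : √v₂ ^ 2 = v₂ := Real.sq_sqrt hv₂.le
  have p₁ : 0 < √v₁ := Real.sqrt_pos.2 hv₁
  have p₂ : 0 < √v₂ := Real.sqrt_pos.2 hv₂
  set r := c / (√v₁ * √v₂) with hr
  have hr1 : r ^ 2 ≤ 1 := by
    rw [hr, div_pow, mul_pow, e₁, e₂, div_le_one (by positivity)]
    exact hc
  have hcr : c = r * (√v₁ * √v₂) := by rw [hr]; field_simp
  refine Measure.ext_of_charFun (funext fun x => ?_)
  rw [charFun_multivariateGaussian (posSemidef_correlation hr1), charFun_apply,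
    integral_map hm.aemeasurable (by fun_prop)]
  have hq : 0 ≤ x 0 ^ 2 + 2 * r * (x 0 * x 1) + x 1 ^ 2 := by
    nlinarith [sq_nonneg (x 0 + r * x 1), mul_nonneg (sub_nonneg.2 hr1) (sq_nonneg (x 1))]
  have key : (G.tilted ℓ).map (fun z => x 0 * ((f z - m₁) / √v₁) + x 1 * ((g z - m₂) / √v₂))
      = gaussianReal 0 (Real.toNNReal (x 0 ^ 2 + 2 * r * (x 0 * x 1) + x 1 ^ 2)) := by
    refine map_tilted_eq_gaussianReal (a := a) (by fun_prop) hq fun s => ?_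
    have e : ∀ z, Real.exp (ℓ z + s * (x 0 * ((f z - m₁) / √v₁) + x 1 * ((g z - m₂) / √v₂)))
        = Real.exp (ℓ z + (s * x 0 / √v₁) * f z + (s * x 1 / √v₂) * g z)
          * Real.exp (-(s * x 0 / √v₁ * m₁) - s * x 1 / √v₂ * m₂) := by
      intro z
      rw [← Real.exp_add]
      congr 1
      ring
    simp_rw [e]
    rw [integral_mul_const, h, ← Real.exp_add]
    congr 1
    rw [hcr]
    have d₁ : (s * x 0 / √v₁) ^ 2 * v₁ = s ^ 2 * x 0 ^ 2 := by
      rw [div_pow, e₁]; field_simp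
    have d₂ : (s * x 1 / √v₂) ^ 2 * v₂ = s ^ 2 * x 1 ^ 2 := by
      rw [div_pow, e₂]; field_simp
    rw [d₁, d₂]
    field_simp
    ring
  have hchar := congrArg (fun ν => charFun ν 1) key
  simp only [charFun_gaussianReal] at hchar
  rw [charFun_apply, integral_map (by fun_prop) (by fun_prop)] at hchar
  refine Eq.trans (integral_congr_ae (.of_forall fun z => ?_)) (hchar.trans ?_)
  · simp [PiLp.inner_apply, Fin.sum_univ_two, mul_comm]
  · congr 1
    rw [Real.coe_toNNReal _ hq]
    simp [dotProduct, Matrix.mulVec, Fin.sum_univ_two]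
    ring

theorem integral_exp_mul_indicator_le_le (hf : Measurable f) (hg : Measurable g)
    (hv₁ : 0 < v₁) (hv₂ : 0 < v₂) (hc : c ^ 2 ≤ v₁ * v₂)
    (h : ∀ s t : ℝ, ∫ z, Real.exp (ℓ z + s * f z + t * g z) ∂G
      = Real.exp (a + s * m₁ + t * m₂ + (s ^ 2 * v₁ + 2 * s * t * c + t ^ 2 * v₂) / 2))
    (x y : ℝ) :
    ∫ z, Real.exp (ℓ z) * {z | f z ≤ x ∧ g z ≤ y}.indicator 1 z ∂G
      = Real.exp a * Phi2 ((x - m₁) / √v₁) ((y - m₂) / √v₂) (c / (√v₁ * √v₂)) := by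
  have h0 : ∫ z, Real.exp (ℓ z) ∂G = Real.exp a := by simpa using h 0 0
  have hm : Measurable fun z =>
      (WithLp.toLp 2 ![(f z - m₁) / √v₁, (g z - m₂) / √v₂] : EuclideanSpace ℝ (Fin 2)) := by
    refine (WithLp.measurable_toLp 2 _).comp (measurable_pi_lambda _ fun i => ?_)
    fin_cases i <;> simp <;> fun_prop
  have p₁ : 0 < √v₁ := Real.sqrt_pos.2 hv₁
  have p₂ : 0 < √v₂ := Real.sqrt_pos.2 hv₂
  have hset : MeasurableSet {z : EuclideanSpace ℝ (Fin 2) |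
      z 0 ≤ (x - m₁) / √v₁ ∧ z 1 ≤ (y - m₂) / √v₂} := by
    refine MeasurableSet.inter ?_ ?_
    · exact measurableSet_le (f := fun z : EuclideanSpace ℝ (Fin 2) => z 0) (by fun_prop)
        measurable_const
    · exact measurableSet_le (f := fun z : EuclideanSpace ℝ (Fin 2) => z 1) (by fun_prop)
        measurable_const
  have hA : MeasurableSet {z | f z ≤ x ∧ g z ≤ y} :=
    (measurableSet_le hf measurable_const).inter (measurableSet_le hg measurable_const)
  rw [integral_exp_mul_indicator_eq h0 hA, Phi2,
    ← map_tilted_eq_multivariateGaussian hf hg hv₁ hv₂ hc h, measureReal_def, measureReal_def,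
    Measure.map_apply hm hset]
  congr 4
  ext z
  simp [div_le_div_iff_of_pos_right p₁, div_le_div_iff_of_pos_right p₂]

theorem integral_exp_mul_indicator_le (hf : Measurable f) (hv₁ : 0 < v₁)
    (h : ∀ s : ℝ, ∫ z, Real.exp (ℓ z + s * f z) ∂G = Real.exp (a + s * m₁ + s ^ 2 * v₁ / 2))
    (x : ℝ) :
    ∫ z, Real.exp (ℓ z) * {z | f z ≤ x}.indicator 1 z ∂G
      = Real.exp a * Phi1 ((x - m₁) / √v₁) := by
  have h0 : ∫ z, Real.exp (ℓ z) ∂G = Real.exp a := by simpa using h 0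
  have p₁ : 0 < √v₁ := Real.sqrt_pos.2 hv₁
  have e₁ : √v₁ ^ 2 = v₁ := Real.sq_sqrt hv₁.le
  have key : (G.tilted ℓ).map (fun z => (f z - m₁) / √v₁) = gaussianReal 0 1 := by
    rw [← Real.toNNReal_one]
    refine map_tilted_eq_gaussianReal (a := a) (by fun_prop) zero_le_one fun s => ?_
    have e : ∀ z, Real.exp (ℓ z + s * ((f z - m₁) / √v₁))
        = Real.exp (ℓ z + (s / √v₁) * f z) * Real.exp (-(s / √v₁ * m₁)) := by
      intro z
      rw [← Real.exp_add]
      congr 1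
      ring
    simp_rw [e]
    rw [integral_mul_const, h, ← Real.exp_add]
    congr 1
    rw [div_pow, e₁]
    field_simp
    ring
  have hm : Measurable fun z => (f z - m₁) / √v₁ := by fun_prop
  rw [integral_exp_mul_indicator_eq h0 (measurableSet_le hf measurable_const), Phi1,
    cdf_eq_real, ← key, measureReal_def, measureReal_def, Measure.map_apply hm measurableSet_Iic]
  congr 4
  ext z
  simp [div_le_div_iff_of_pos_right p₁]

/-- A nondegenerate Gaussian random variable hits a given level with probability zero. -/
theorem ae_ne_of_mgf (hf : Measurable f) (hv₁ : 0 < v₁)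
    (h : ∀ s : ℝ, ∫ z, Real.exp (s * f z) ∂G = Real.exp (s * m₁ + s ^ 2 * v₁ / 2)) (x : ℝ) :
    ∀ᵐ z ∂G, f z ≠ x := by
  have key : (G.tilted fun _ => 0).map f = gaussianReal m₁ v₁.toNNReal :=
    map_tilted_eq_gaussianReal (a := 0) hf hv₁.le fun s => by simpa using h s
  rw [tilted_const] at key
  have : NullSingletonClass (gaussianReal m₁ v₁.toNNReal) :=
    nullSingletonClass_gaussianReal (by simpa using hv₁)
  have h0 : G.map f {x} = 0 := by rw [key]; simp
  rw [Measure.map_apply hf (measurableSet_singleton x)] at h0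
  rw [ae_iff]
  simpa [Set.preimage] using h0

end GaussianTilt

namespace BidCurves

variable (B : BidCurves)

theorem sum_fuel (f : Fuel → ℝ) : ∑ i, f i = f .c + f .g := by
  rw [show (Finset.univ : Finset Fuel) = {Fuel.c, Fuel.g} from rfl,
    Finset.sum_insert (by simp), Finset.sum_singleton]

theorem totalCap_eq : B.totalCap = B.cap .c + B.cap .g := sum_fuel _

theorem bid_strictMono (i : Fuel) {s : ℝ} (hs : 0 < s) : StrictMono fun ξ => B.bid i ξ s := by
  intro ξ ξ' h
  exact mul_lt_mul_of_pos_left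
    (Real.exp_lt_exp.2 (by linarith [mul_lt_mul_of_pos_left h (B.m_pos i)])) hs

theorem bddBelow_bidInv (i : Fuel) (p s : ℝ) :
    BddBelow (insert (B.cap i) {ξ : ℝ | ξ ∈ Set.Ioc 0 (B.cap i) ∧ p < B.bid i ξ s}) := by
  refine ⟨0, ?_⟩
  rintro ξ (rfl | h)
  · exact (B.cap_pos i).le
  · exact h.1.1.le

theorem bidInv_mono (i : Fuel) (s : ℝ) : Monotone fun p => B.bidInv i p s := by
  intro p p' h
  refine csInf_le_csInf (B.bddBelow_bidInv i p s) ⟨_, Set.mem_insert _ _⟩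
    (Set.insert_subset_insert ?_)
  exact fun ξ hξ => ⟨hξ.1, h.trans_lt hξ.2⟩

theorem bidInv_eq {i : Fuel} {p s x : ℝ} (hs : 0 < s) (hx : 0 ≤ x) (hx' : x ≤ B.cap i)
    (h1 : 0 < x → B.bid i x s ≤ p) (h2 : x < B.cap i → p ≤ B.bid i x s) :
    B.bidInv i p s = x := by
  refine le_antisymm ?_ ?_
  · rcases hx'.eq_or_lt with rfl | hlt
    · exact csInf_le (B.bddBelow_bidInv i p s) (Set.mem_insert _ _)
    · refine le_of_forall_gt_imp_ge_of_dense fun y hy => ?_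
      have hmem : min y (B.cap i) ∈ {ξ : ℝ | ξ ∈ Set.Ioc 0 (B.cap i) ∧ p < B.bid i ξ s} := by
        exact ⟨⟨hx.trans_lt (lt_min hy hlt), min_le_right _ _⟩,
          (h2 hlt).trans_lt (B.bid_strictMono i hs (lt_min hy hlt))⟩
      exact (csInf_le (B.bddBelow_bidInv i p s)
        (Set.mem_insert_of_mem _ hmem)).trans (min_le_left _ _)
  · refine le_csInf ⟨_, Set.mem_insert _ _⟩ ?_
    rintro ξ (rfl | h)
    · exact hx'
    · by_contra! hlt
      exact absurd ((h1 (h.1.1.trans hlt)).trans_lt h.2)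
        (B.bid_strictMono i hs hlt).le.not_gt

theorem bidInv_nonneg (i : Fuel) (p s : ℝ) : 0 ≤ B.bidInv i p s := by
  refine le_csInf ⟨_, Set.mem_insert _ _⟩ ?_
  rintro ξ (rfl | h)
  · exact (B.cap_pos i).le
  · exact h.1.1.le

theorem bidInv_lt {i : Fuel} {p s x : ℝ} (hx : 0 < x) (hx' : x ≤ B.cap i)
    (hp : p < B.bid i x s) : B.bidInv i p s < x := by
  have hcont : ContinuousAt (fun ξ => B.bid i ξ s) x := by
    unfold bid
    fun_prop
  have h1 : ∀ᶠ ξ in nhdsWithin x (Set.Iio x), p < B.bid i ξ s :=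
    (hcont.eventually (lt_mem_nhds hp)).filter_mono nhdsWithin_le_nhds
  have h2 : ∀ᶠ ξ in nhdsWithin x (Set.Iio x), ξ ∈ Set.Ioo 0 x := Ioo_mem_nhdsLT hx
  obtain ⟨ξ, hξ, hξ'⟩ := (h1.and h2).exists
  exact (csInf_le (B.bddBelow_bidInv i p s)
    (Set.mem_insert_of_mem _ ⟨⟨hξ'.1, hξ'.2.le.trans hx'⟩, hξ⟩)).trans_lt hξ'.2

/-- The bid stack at the price `p` at which the fuels supply the quantities `q`. -/
theorem stack_eq {s q : Fuel → ℝ} {p ξ : ℝ} (hs : ∀ i, 0 < s i) (hq : ∀ i, 0 ≤ q i)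
    (hq' : ∀ i, q i ≤ B.cap i) (h1 : ∀ i, 0 < q i → B.bid i (q i) (s i) ≤ p)
    (h2 : ∀ i, q i < B.cap i → p ≤ B.bid i (q i) (s i))
    (i : Fuel) (hi : 0 < q i) (hpi : p = B.bid i (q i) (s i)) (hξ : ξ = q .c + q .g) :
    B.stack ξ s = p := by
  have hG : ∀ j, B.bidInv j p (s j) = q j := fun j =>
    B.bidInv_eq (hs j) (hq j) (hq' j) (h1 j) (h2 j)
  have hset : {p' : ℝ | ∑ j, B.bidInv j p' (s j) < ξ} = Set.Iio p := by
    have hξ' : ξ = ∑ j, q j := by rw [sum_fuel, hξ]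
    ext p'
    simp only [Set.mem_ofPred_eq, Set.mem_Iio, hξ']
    constructor
    · intro h
      by_contra! hle
      refine absurd h (not_lt.2 (Finset.sum_le_sum fun j _ => ?_))
      rw [← hG j]
      exact B.bidInv_mono j (s j) hle
    · intro h
      refine Finset.sum_lt_sum (fun j _ => ?_) ⟨i, Finset.mem_univ _, ?_⟩
      · rw [← hG j]
        exact B.bidInv_mono j (s j) h.le
      · exact B.bidInv_lt hi (hq' i) (hpi ▸ h)
  have hmin : min (B.bid .c 0 (s .c)) (B.bid .g 0 (s .g)) ≤ p := by
    have h0 : B.bid i 0 (s i) ≤ p := hpi ▸ (B.bid_strictMono i (hs i)).monotone hi.le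
    cases i
    · exact (min_le_left _ _).trans h0
    · exact (min_le_right _ _).trans h0
  rw [stack, hset]
  have hlub : IsLUB (insert (min (B.bid .c 0 (s .c)) (B.bid .g 0 (s .g))) (Set.Iio p)) p := by
    have := (isLUB_Iio (a := p)).insert (min (B.bid .c 0 (s .c)) (B.bid .g 0 (s .g)))
    rwa [sup_eq_right.2 hmin] at this
  exact hlub.csSup_eq ⟨_, Set.mem_insert _ _⟩

theorem stack_zero (s : Fuel → ℝ) :
    B.stack 0 s = min (B.bid .c 0 (s .c)) (B.bid .g 0 (s .g)) := by
  have hset : {p : ℝ | ∑ j, B.bidInv j p (s j) < 0} = ∅ := by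
    ext p
    simpa using Finset.sum_nonneg fun j _ => B.bidInv_nonneg j p (s j)
  rw [stack, hset]
  simp

end BidCurves

/-- Fuel prices with given logarithms. -/
def expPrice (y : Fuel → ℝ) : Fuel → ℝ := fun i => Real.exp (y i)

namespace BidCurves

variable (B : BidCurves)

theorem bid_exp (i : Fuel) (ξ y : ℝ) :
    B.bid i ξ (Real.exp y) = Real.exp (y + B.k i + B.m i * ξ) := by
  rw [bid, ← Real.exp_add, add_assoc]

/-- The quantity of electricity produced from coal if demand is `x` and both fuels are
marginal. -/
def coalShare (y : Fuel → ℝ) (x : ℝ) : ℝ :=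
  (y .g + B.k .g - y .c - B.k .c + B.m .g * x) / (B.m .c + B.m .g)

theorem coalShare_spec (y : Fuel → ℝ) (x : ℝ) :
    y .g + B.k .g = y .c + B.k .c + B.m .c * B.coalShare y x
      + B.m .g * (B.coalShare y x - x) := by
  have := B.m_pos .c
  have := B.m_pos .g
  rw [coalShare]
  field_simp
  ring

variable {B} {y : Fuel → ℝ} {x : ℝ}

theorem stack_expPrice {q : Fuel → ℝ} {l ξ : ℝ} (hq : ∀ i, 0 ≤ q i)
    (hq' : ∀ i, q i ≤ B.cap i) (h1 : ∀ i, 0 < q i → y i + B.k i + B.m i * q i ≤ l)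
    (h2 : ∀ i, q i < B.cap i → l ≤ y i + B.k i + B.m i * q i)
    (i : Fuel) (hi : 0 < q i) (hpi : l = y i + B.k i + B.m i * q i) (hξ : ξ = q .c + q .g) :
    B.stack ξ (expPrice y) = Real.exp l := by
  refine B.stack_eq (fun i => Real.exp_pos _) hq hq' ?_ ?_ i hi ?_ hξ
  · intro j hj
    rw [expPrice, bid_exp]
    exact Real.exp_le_exp.2 (h1 j hj)
  · intro j hj
    rw [expPrice, bid_exp]
    exact Real.exp_le_exp.2 (h2 j hj)
  · rw [expPrice, bid_exp, hpi]

theorem stack_of_coal_only (hx : 0 < x) (hxc : x ≤ B.cap .c) (hz : x ≤ B.coalShare y x) :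
    B.stack x (expPrice y) = Real.exp (y .c + B.k .c + B.m .c * x) := by
  have hs := B.coalShare_spec y x
  have hc := B.m_pos .c
  have hg := B.m_pos .g
  have p1 := mul_le_mul_of_nonneg_left hz hc.le
  have p2 := mul_le_mul_of_nonneg_left hz hg.le
  clear hc hg
  have h3 := B.cap_pos .g
  refine stack_expPrice (q := fun | .c => x | .g => 0) ?_ ?_ ?_ ?_ .c hx rfl (by simp) <;>
    rintro (_ | _) <;> intros <;> simp_all <;> linarith

theorem stack_of_gas_only (hx : 0 < x) (hxg : x ≤ B.cap .g) (hz : B.coalShare y x ≤ 0) :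
    B.stack x (expPrice y) = Real.exp (y .g + B.k .g + B.m .g * x) := by
  have hs := B.coalShare_spec y x
  have hc := B.m_pos .c
  have hg := B.m_pos .g
  have p1 := mul_le_mul_of_nonneg_left hz hc.le
  have p2 := mul_le_mul_of_nonneg_left hz hg.le
  clear hc hg
  have h3 := B.cap_pos .c
  refine stack_expPrice (q := fun | .c => 0 | .g => x) ?_ ?_ ?_ ?_ .g hx rfl (by simp) <;>
    rintro (_ | _) <;> intros <;> simp_all <;> linarith

theorem stack_of_coal_full (hx : B.cap .c < x) (hxt : x ≤ B.totalCap)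
    (hz : B.cap .c ≤ B.coalShare y x) :
    B.stack x (expPrice y) = Real.exp (y .g + B.k .g + B.m .g * (x - B.cap .c)) := by
  have hs := B.coalShare_spec y x
  have hc := B.m_pos .c
  have hg := B.m_pos .g
  have p1 := mul_le_mul_of_nonneg_left hz hc.le
  have p2 := mul_le_mul_of_nonneg_left hz hg.le
  clear hc hg
  have h3 := B.cap_pos .c
  rw [totalCap_eq] at hxt
  refine stack_expPrice (q := fun | .c => B.cap .c | .g => x - B.cap .c) ?_ ?_ ?_ ?_ .g
    (sub_pos.2 hx) rfl (by simp) <;>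
    rintro (_ | _) <;> intros <;> simp_all <;> linarith

theorem stack_of_gas_full (hx : B.cap .g < x) (hxt : x ≤ B.totalCap)
    (hz : B.coalShare y x ≤ x - B.cap .g) :
    B.stack x (expPrice y) = Real.exp (y .c + B.k .c + B.m .c * (x - B.cap .g)) := by
  have hs := B.coalShare_spec y x
  have hc := B.m_pos .c
  have hg := B.m_pos .g
  have p1 := mul_le_mul_of_nonneg_left hz hc.le
  have p2 := mul_le_mul_of_nonneg_left hz hg.le
  clear hc hg
  have h3 := B.cap_pos .g
  rw [totalCap_eq] at hxt
  refine stack_expPrice (q := fun | .c => x - B.cap .g | .g => B.cap .g) ?_ ?_ ?_ ?_ .c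
    (sub_pos.2 hx) rfl (by simp) <;>
    rintro (_ | _) <;> intros <;> simp_all <;> linarith

theorem stack_of_both (h0 : 0 < B.coalShare y x) (hx : B.coalShare y x < x)
    (hc : B.coalShare y x ≤ B.cap .c) (hg : x - B.cap .g ≤ B.coalShare y x) :
    B.stack x (expPrice y) = Real.exp (y .c + B.k .c + B.m .c * B.coalShare y x) := by
  have hs := B.coalShare_spec y x
  refine stack_expPrice (q := fun | .c => B.coalShare y x | .g => x - B.coalShare y x)
    ?_ ?_ ?_ ?_ .c h0 rfl (by simp) <;>
    rintro (_ | _) <;> intros <;> simp_all <;> linarith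

theorem stack_totalCap (y : Fuel → ℝ) (i : Fuel)
    (h : y i.other + B.k i.other + B.m i.other * B.cap i.other ≤ y i + B.k i + B.m i * B.cap i) :
    B.stack B.totalCap (expPrice y) = Real.exp (y i + B.k i + B.m i * B.cap i) := by
  refine stack_expPrice (q := B.cap) (fun j => (B.cap_pos j).le) (fun _ => le_rfl) ?_ ?_ i
    (B.cap_pos i) rfl B.totalCap_eq
  · intro j _
    cases i <;> cases j <;> first | exact le_rfl | exact h
  · intro j hj
    exact absurd hj (lt_irrefl _)

end BidCurves

/-- The indicator of a proposition, as a real number. -/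
def ind (p : Prop) [Decidable p] : ℝ := if p then 1 else 0

theorem ind_true {p : Prop} [Decidable p] (h : p) : ind p = 1 := if_pos h

theorem ind_false {p : Prop} [Decidable p] (h : ¬p) : ind p = 0 := if_neg h

namespace BidCurves

variable {B : BidCurves} {y : Fuel → ℝ} {x h : ℝ}

theorem demand_of_mem (h0 : 0 ≤ x) (hx : x ≤ B.totalCap) : B.demand x = x := by
  rw [demand, min_eq_right hx, max_eq_right h0]

theorem totalCap_pos : 0 < B.totalCap := by
  rw [totalCap_eq]
  exact add_pos (B.cap_pos _) (B.cap_pos _)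

theorem mul_expPrice_coal (hh : 0 < h) :
    h * expPrice y .c = Real.exp (y .c + B.k .c + B.m .c * B.xiH h) := by
  have := B.m_pos .c
  have e : y .c + B.k .c + B.m .c * B.xiH h = Real.log h + y .c := by
    rw [xiH]
    field_simp
    ring
  rw [e, Real.exp_add, Real.exp_log hh, expPrice]

/-- The five possible configurations of marginal fuels. -/
theorem stack_cases (y : Fuel → ℝ) (h0 : 0 < x) (hx : x ≤ B.totalCap) :
    (x ≤ B.cap .c ∧ x ≤ B.coalShare y x ∧
        B.stack x (expPrice y) = Real.exp (y .c + B.k .c + B.m .c * x)) ∨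
      (B.cap .c < x ∧ B.cap .c ≤ B.coalShare y x ∧
        B.stack x (expPrice y) = Real.exp (y .g + B.k .g + B.m .g * (x - B.cap .c))) ∨
      (x ≤ B.cap .g ∧ B.coalShare y x ≤ 0 ∧
        B.stack x (expPrice y) = Real.exp (y .g + B.k .g + B.m .g * x)) ∨
      (B.cap .g < x ∧ B.coalShare y x ≤ x - B.cap .g ∧
        B.stack x (expPrice y) = Real.exp (y .c + B.k .c + B.m .c * (x - B.cap .g))) ∨
      (0 < B.coalShare y x ∧ B.coalShare y x < x ∧ (B.cap .c < x → B.coalShare y x < B.cap .c) ∧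
        (B.cap .g < x → x - B.cap .g < B.coalShare y x) ∧
        B.stack x (expPrice y) = Real.exp (y .c + B.k .c + B.m .c * B.coalShare y x)) := by
  have hc := B.cap_pos .c
  have hg := B.cap_pos .g
  by_cases ha : x ≤ B.cap .c ∧ x ≤ B.coalShare y x
  · exact .inl ⟨ha.1, ha.2, stack_of_coal_only h0 ha.1 ha.2⟩
  by_cases hb : B.cap .c < x ∧ B.cap .c ≤ B.coalShare y x
  · exact .inr (.inl ⟨hb.1, hb.2, stack_of_coal_full hb.1 hx hb.2⟩)
  by_cases hd : x ≤ B.cap .g ∧ B.coalShare y x ≤ 0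
  · exact .inr (.inr (.inl ⟨hd.1, hd.2, stack_of_gas_only h0 hd.1 hd.2⟩))
  by_cases he : B.cap .g < x ∧ B.coalShare y x ≤ x - B.cap .g
  · exact .inr (.inr (.inr (.inl ⟨he.1, he.2, stack_of_gas_full he.1 hx he.2⟩)))
  have h1 : 0 < B.coalShare y x := by
    by_contra! h
    rcases le_or_gt x (B.cap .g) with h' | h'
    · exact hd ⟨h', h⟩
    · exact he ⟨h', by linarith⟩
  have h2 : B.coalShare y x < x := by
    by_contra! h
    rcases le_or_gt x (B.cap .c) with h' | h'
    · exact ha ⟨h', h⟩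
    · exact hb ⟨h', by linarith⟩
  have h3 : B.cap .c < x → B.coalShare y x < B.cap .c := fun h => by
    by_contra! h'
    exact hb ⟨h, h'⟩
  have h4 : B.cap .g < x → x - B.cap .g < B.coalShare y x := fun h => by
    by_contra! h'
    exact he ⟨h, h'⟩
  refine .inr (.inr (.inr (.inr ⟨h1, h2, h3, h4, stack_of_both h1 h2 ?_ ?_⟩)))
  · rcases le_or_gt x (B.cap .c) with h | h
    · linarith
    · exact (h3 h).le
  · rcases le_or_gt x (B.cap .g) with h | h
    · linarith
    · exact (h4 h).le

theorem gas_exp_eq (y : Fuel → ℝ) (x t : ℝ) :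
    y .g + B.k .g + B.m .g * t = y .c + B.k .c + B.m .c * B.coalShare y x
      + B.m .g * (B.coalShare y x - x + t) := by
  rw [B.coalShare_spec y x]
  ring

theorem payoff_of_le (hh : 0 < h) (h0 : 0 ≤ B.xiH h) (hc : B.xiH h ≤ B.cap .c)
    (hx : x ≤ B.xiH h) : B.payoff h (expPrice y) x = 0 := by
  have mc := B.m_pos .c
  have mg := B.m_pos .g
  rw [payoff, mul_expPrice_coal (B := B) hh]
  refine max_eq_right (sub_nonpos.2 ?_)
  rcases le_or_gt x 0 with hx0 | hx0
  · rw [demand, max_eq_left ((min_le_right _ _).trans hx0), stack_zero, expPrice, bid_exp]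
    refine (min_le_left _ _).trans (Real.exp_le_exp.2 ?_)
    linarith [mul_nonneg mc.le h0]
  have hgp := B.cap_pos .g
  have hxt : x ≤ B.totalCap := by
    rw [totalCap_eq]
    linarith
  rw [demand_of_mem hx0.le hxt]
  rcases stack_cases y hx0 hxt with ⟨h1, h2, h3⟩ | ⟨h1, h2, h3⟩ | ⟨h1, h2, h3⟩ | ⟨h1, h2, h3⟩ |
    ⟨h1, h2, -, -, h3⟩ <;> rw [h3, Real.exp_le_exp]
  · nlinarith
  · linarith
  · rw [gas_exp_eq y x]
    nlinarith [mul_nonneg mc.le (sub_nonneg.2 (h2.trans h0)), mul_nonneg mg.le (neg_nonneg.2 h2)]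
  · nlinarith [mul_nonneg mc.le (show 0 ≤ B.xiH h - (x - B.cap .g) by linarith)]
  · nlinarith

theorem payoff_of_totalCap_lt (hh : 0 < h) (hc : B.xiH h ≤ B.cap .c)
    (hx : B.totalCap < x) : B.payoff h (expPrice y) x =
      Real.exp (y .c + B.k .c + B.m .c * B.cap .c)
          * ind (y .g + B.k .g + B.m .g * B.cap .g ≤ y .c + B.k .c + B.m .c * B.cap .c)
        + Real.exp (y .g + B.k .g + B.m .g * B.cap .g)
          * (1 - ind (y .g + B.k .g + B.m .g * B.cap .g ≤ y .c + B.k .c + B.m .c * B.cap .c))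
        - Real.exp (y .c + B.k .c + B.m .c * B.xiH h) := by
  have mc := B.m_pos .c
  rw [payoff, mul_expPrice_coal (B := B) hh, demand, min_eq_left hx.le,
    max_eq_right totalCap_pos.le]
  have h1 : B.m .c * B.xiH h ≤ B.m .c * B.cap .c := mul_le_mul_of_nonneg_left hc mc.le
  by_cases hle : y .g + B.k .g + B.m .g * B.cap .g ≤ y .c + B.k .c + B.m .c * B.cap .c
  · rw [ind_true hle, stack_totalCap y .c hle, max_eq_left]
    · ring
    · rw [sub_nonneg, Real.exp_le_exp]
      linarith
  · rw [ind_false hle, stack_totalCap y .g (not_le.1 hle).le, max_eq_left]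
    · ring
    · rw [sub_nonneg, Real.exp_le_exp]
      linarith

theorem payoff_of_mem (hh : 0 < h) (h0 : 0 ≤ B.xiH h) (hc : B.xiH h ≤ B.cap .c)
    (hx : B.xiH h < x) (hxt : x < B.totalCap) :
    B.payoff h (expPrice y) x =
      Real.exp (y .c + B.k .c + B.m .c * x) * (ind (x ≤ B.cap .c) * ind (x ≤ B.coalShare y x))
      + Real.exp (y .c + B.k .c + B.m .c * (x - B.cap .g))
        * ((1 - ind (x ≤ B.cap .g + B.xiH h)) * ind (B.coalShare y x ≤ x - B.cap .g))
      + Real.exp (y .g + B.k .g + B.m .g * (x - B.cap .c))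
        * ((1 - ind (x ≤ B.cap .c)) * ind (B.cap .c ≤ B.coalShare y x))
      - Real.exp (y .c + B.k .c + B.m .c * B.xiH h)
        * (ind (x ≤ B.cap .g + B.xiH h) * ind (B.xiH h ≤ B.coalShare y x))
      + Real.exp (y .c + B.k .c + B.m .c * B.coalShare y x)
        * (ind (x ≤ B.cap .c) * (1 - ind (x ≤ B.coalShare y x))
          - (1 - ind (x ≤ B.cap .g + B.xiH h)) * ind (B.coalShare y x ≤ x - B.cap .g)
          + (1 - ind (x ≤ B.cap .c)) * (1 - ind (B.cap .c ≤ B.coalShare y x))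
          - ind (x ≤ B.cap .g + B.xiH h) * (1 - ind (B.xiH h ≤ B.coalShare y x)))
      - Real.exp (y .c + B.k .c + B.m .c * B.xiH h) * (1 - ind (x ≤ B.cap .g + B.xiH h)) := by
  have mc := B.m_pos .c
  have mg := B.m_pos .g
  have cc := B.cap_pos .c
  have cg := B.cap_pos .g
  have hx0 : 0 < x := h0.trans_lt hx
  have ht := B.totalCap_eq
  rw [payoff, mul_expPrice_coal (B := B) hh, demand_of_mem hx0.le hxt.le]
  rcases stack_cases y hx0 hxt.le with ⟨h1, h2, h3⟩ | ⟨h1, h2, h3⟩ | ⟨h1, h2, h3⟩ |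
    ⟨h1, h2, h3⟩ | ⟨h1, h2, h4, h5, h3⟩ <;> rw [h3]
  · rw [ind_true h1, ind_true h2, ind_true (show B.xiH h ≤ B.coalShare y x by linarith),
      ind_false (show ¬ B.coalShare y x ≤ x - B.cap .g by linarith), max_eq_left]
    · ring
    · rw [sub_nonneg, Real.exp_le_exp]
      nlinarith
  · rw [ind_false (not_le.2 h1), ind_true h2,
      ind_true (show B.xiH h ≤ B.coalShare y x by linarith),
      ind_false (show ¬ B.coalShare y x ≤ x - B.cap .g by linarith), max_eq_left]
    · ring
    · rw [sub_nonneg, Real.exp_le_exp, gas_exp_eq y x]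
      nlinarith [mul_nonneg mc.le (show 0 ≤ B.coalShare y x - B.xiH h by linarith),
        mul_nonneg mg.le (show 0 ≤ B.coalShare y x - B.cap .c by linarith)]
  · rw [ind_false (show ¬ x ≤ B.coalShare y x by linarith),
      ind_true (show x ≤ B.cap .g + B.xiH h by linarith),
      ind_false (show ¬ B.cap .c ≤ B.coalShare y x by linarith), max_eq_right]
    · by_cases hz : B.xiH h ≤ B.coalShare y x
      · rw [ind_true hz, show B.coalShare y x = B.xiH h by linarith]
        ring
      · rw [ind_false hz]
        ring
    · rw [sub_nonpos, Real.exp_le_exp, gas_exp_eq y x]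
      nlinarith [mul_nonneg mc.le (sub_nonneg.2 (h2.trans h0)), mul_nonneg mg.le (neg_nonneg.2 h2)]
  · rw [ind_false (show ¬ x ≤ B.coalShare y x by linarith), ind_true h2,
      ind_false (show ¬ B.cap .c ≤ B.coalShare y x by linarith)]
    by_cases hx' : x ≤ B.cap .g + B.xiH h
    · rw [ind_true hx', max_eq_right]
      · by_cases hz : B.xiH h ≤ B.coalShare y x
        · rw [ind_true hz, show B.coalShare y x = B.xiH h by linarith]
          ring
        · rw [ind_false hz]
          ring
      · rw [sub_nonpos, Real.exp_le_exp]
        nlinarith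
    · rw [ind_false hx', max_eq_left]
      · ring
      · rw [sub_nonneg, Real.exp_le_exp]
        nlinarith
  · rw [ind_false (show ¬ x ≤ B.coalShare y x by linarith)]
    have e1 : (1 - ind (x ≤ B.cap .c)) * ind (B.cap .c ≤ B.coalShare y x) = 0 := by
      rcases le_or_gt x (B.cap .c) with h | h
      · rw [ind_true h]; ring
      · rw [ind_false (not_le.2 (h4 h))]; ring
    have e2 : (1 - ind (x ≤ B.cap .g + B.xiH h)) * ind (B.coalShare y x ≤ x - B.cap .g) = 0 := by
      rcases le_or_gt x (B.cap .g) with h | h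
      · rw [ind_true (by linarith)]; ring
      · rw [ind_false (not_le.2 (h5 h))]; ring
    have e3 : (1 - ind (x ≤ B.cap .c)) * (1 - ind (B.cap .c ≤ B.coalShare y x))
        = 1 - ind (x ≤ B.cap .c) := by linear_combination -e1
    rw [e1, e2, e3]
    by_cases hz : B.xiH h ≤ B.coalShare y x
    · rw [ind_true hz, max_eq_left]
      · ring
      · rw [sub_nonneg, Real.exp_le_exp]
        nlinarith
    · have hx' : x ≤ B.cap .g + B.xiH h := by
        by_contra! hlt
        linarith [h5 (by linarith)]
      rw [ind_false hz, ind_true hx', max_eq_right]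
      · ring
      · rw [sub_nonpos, Real.exp_le_exp]
        nlinarith

end BidCurves

/-- The number of intervals `(a 1 i, a 0 i]` that contain `x`, counted with the sign of their
orientation. -/
def netCount {n : ℕ} (a : Matrix (Fin 2) (Fin n) ℝ) (x : ℝ) : ℝ :=
  ∑ i, (ind (x ≤ a 0 i) - ind (x ≤ a 1 i))

theorem netCount_two (a b c d x : ℝ) : netCount !![a, b; c, d] x
    = ind (x ≤ a) - ind (x ≤ c) + (ind (x ≤ b) - ind (x ≤ d)) := by
  simp only [netCount, Fin.sum_univ_two]
  rfl

theorem netCount_three (a b c d e f x : ℝ) : netCount !![a, b, c; d, e, f] x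
    = ind (x ≤ a) - ind (x ≤ d) + (ind (x ≤ b) - ind (x ≤ e)) + (ind (x ≤ c) - ind (x ≤ f)) := by
  simp only [netCount, Fin.sum_univ_three]
  rfl

theorem netCount_one (a b x : ℝ) : netCount !![a; b] x = ind (x ≤ a) - ind (x ≤ b) := by
  simp only [netCount, Fin.sum_univ_one]
  rfl

namespace BidCurves

variable {B : BidCurves} {y : Fuel → ℝ} {x h : ℝ}

theorem netCount_coal (hc : B.xiH h ≤ B.cap .c) :
    netCount !![B.cap .c, B.level h 2; B.level h 3, B.level h 1] x
      = ind (x ≤ B.cap .c) - ind (x ≤ B.xiH h) := by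
  have h1 : B.level h 1 = min (B.cap .g) (B.xiH h) := rfl
  have h2 : B.level h 2 = min (B.cap .c) (B.cap .g) := rfl
  have h3 : B.level h 3 = max (min (B.cap .c) (B.cap .g)) (B.xiH h) := rfl
  rw [netCount_two, h1, h2, h3]
  rcases le_total (B.cap .c) (B.cap .g) with h4 | h4
  · rw [min_eq_left h4, max_eq_left hc, min_eq_right (hc.trans h4)]
    ring
  · rw [min_eq_right h4]
    rcases le_total (B.cap .g) (B.xiH h) with h5 | h5
    · rw [min_eq_left h5, max_eq_right h5]
      ring
    · rw [min_eq_right h5, max_eq_left h5]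
      ring

theorem netCount_gas_full (h0 : 0 ≤ B.xiH h) :
    netCount !![B.level h 7, B.level h 5; B.level h 6, B.level h 4] x
      = ind (x ≤ B.totalCap) - ind (x ≤ B.cap .g + B.xiH h) := by
  have h1 : B.level h 4 = min (max (B.cap .c) (B.cap .g)) (B.cap .g + B.xiH h) := rfl
  have h2 : B.level h 5 = max (B.cap .c) (B.cap .g) := rfl
  have h3 : B.level h 6 = max (B.cap .c) (B.cap .g + B.xiH h) := rfl
  have h7 : B.level h 7 = B.totalCap := rfl
  rw [netCount_two, h1, h2, h3, h7]
  rcases le_total (B.cap .c) (B.cap .g) with h4 | h4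
  · rw [max_eq_right h4, max_eq_right (by linarith), min_eq_left (by linarith)]
    ring
  · rw [max_eq_left h4]
    rcases le_total (B.cap .c) (B.cap .g + B.xiH h) with h5 | h5
    · rw [max_eq_right h5, min_eq_left h5]
      ring
    · rw [max_eq_left h5, min_eq_right h5]
      ring

theorem netCount_coal_full :
    netCount !![B.level h 7; B.cap .c] x = ind (x ≤ B.totalCap) - ind (x ≤ B.cap .c) :=
  netCount_one _ _ _

theorem level_count (h0 : 0 ≤ B.xiH h) :
    1 - ind (x ≤ B.level h 6) + ind (x ≤ B.level h 5) - ind (x ≤ B.level h 4)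
      = 1 - ind (x ≤ B.cap .g + B.xiH h) := by
  have h1 := netCount_gas_full (x := x) h0
  have h7 : B.level h 7 = B.totalCap := rfl
  rw [netCount_two, h7] at h1
  linarith

theorem netCount_option (h0 : 0 ≤ B.xiH h) (hc : B.xiH h ≤ B.cap .c) :
    netCount !![B.level h 6, B.level h 4, B.level h 2; B.level h 5, B.level h 3, B.level h 1] x
      = ind (x ≤ B.cap .g + B.xiH h) - ind (x ≤ B.xiH h) := by
  have h1 := level_count (x := x) h0
  have h2 := netCount_coal (x := x) hc
  rw [netCount_two] at h2
  rw [netCount_three]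
  linarith

/-- The payoff in terms of the logarithms of the fuel prices. -/
theorem payoff_expPrice (hh : 0 < h) (h0 : 0 ≤ B.xiH h) (hc : B.xiH h ≤ B.cap .c)
    (hx : x ≠ B.totalCap) :
    B.payoff h (expPrice y) x =
      Real.exp (y .c + B.k .c + B.m .c * x)
        * (netCount !![B.cap .c, B.level h 2; B.level h 3, B.level h 1] x
          * ind (x ≤ B.coalShare y x))
      + Real.exp (y .c + B.k .c + B.m .c * (x - B.cap .g))
        * (netCount !![B.level h 7, B.level h 5; B.level h 6, B.level h 4] x
          * ind (B.coalShare y x ≤ x - B.cap .g))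
      + Real.exp (y .g + B.k .g + B.m .g * (x - B.cap .c))
        * (netCount !![B.level h 7; B.cap .c] x * ind (B.cap .c ≤ B.coalShare y x))
      - Real.exp (y .c + B.k .c + B.m .c * B.xiH h)
        * (netCount !![B.level h 6, B.level h 4, B.level h 2;
            B.level h 5, B.level h 3, B.level h 1] x * ind (B.xiH h ≤ B.coalShare y x))
      + Real.exp (y .c + B.k .c + B.m .c * B.coalShare y x)
        * (netCount !![B.cap .c, B.level h 2; B.level h 3, B.level h 1] x
            * (1 - ind (x ≤ B.coalShare y x))
          - netCount !![B.level h 7, B.level h 5; B.level h 6, B.level h 4] x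
            * ind (B.coalShare y x ≤ x - B.cap .g)
          + netCount !![B.level h 7; B.cap .c] x * (1 - ind (B.cap .c ≤ B.coalShare y x))
          - netCount !![B.level h 6, B.level h 4, B.level h 2;
            B.level h 5, B.level h 3, B.level h 1] x * (1 - ind (B.xiH h ≤ B.coalShare y x)))
      + ind (B.totalCap ≤ x) * (Real.exp (y .c + B.k .c + B.m .c * B.cap .c)
          * ind (y .g + B.k .g + B.m .g * B.cap .g ≤ y .c + B.k .c + B.m .c * B.cap .c)
        + Real.exp (y .g + B.k .g + B.m .g * B.cap .g)
          * (1 - ind (y .g + B.k .g + B.m .g * B.cap .g ≤ y .c + B.k .c + B.m .c * B.cap .c)))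
      - Real.exp (y .c + B.k .c + B.m .c * B.xiH h)
        * (1 - ind (x ≤ B.level h 6) + ind (x ≤ B.level h 5) - ind (x ≤ B.level h 4)) := by
  rw [netCount_coal hc, netCount_gas_full h0, netCount_coal_full, netCount_option h0 hc,
    level_count h0]
  have ht := B.totalCap_eq
  have cg := B.cap_pos .g
  rcases le_or_gt x (B.xiH h) with h1 | h1
  · rw [payoff_of_le hh h0 hc h1, ind_true h1, ind_true (show x ≤ B.cap .c by linarith),
      ind_true (show x ≤ B.totalCap by linarith),
      ind_true (show x ≤ B.cap .g + B.xiH h by linarith),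
      ind_false (show ¬ B.totalCap ≤ x by linarith)]
    ring
  rcases hx.lt_or_gt with h2 | h2
  · rw [payoff_of_mem hh h0 hc h1 h2, ind_false (not_le.2 h1), ind_true h2.le,
      ind_false (not_le.2 h2)]
    ring
  · rw [payoff_of_totalCap_lt hh hc h2, ind_false (not_le.2 h1), ind_true h2.le,
      ind_false (not_le.2 h2), ind_false (show ¬ x ≤ B.cap .c by linarith),
      ind_false (show ¬ x ≤ B.cap .g + B.xiH h by linarith)]
    ring

end BidCurves

section LogLaw

variable {σ : Fuel → ℝ} {ρ : ℝ}

theorem posSemidef_logCov (hρ : |ρ| ≤ 1) : (logCov σ ρ).PosSemidef := by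
  have hρ2 : ρ ^ 2 ≤ 1 := (sq_le_one_iff_abs_le_one ρ).2 hρ
  refine Matrix.PosSemidef.of_dotProduct_mulVec_nonneg ?_ fun x => ?_
  · ext i j
    cases i <;> cases j <;> simp [logCov] <;> ring
  · simp [Matrix.mulVec, dotProduct, BidCurves.sum_fuel, logCov]
    nlinarith [sq_nonneg (x .c * σ .c + ρ * (x .g * σ .g)),
      mul_nonneg (sub_nonneg.2 hρ2) (sq_nonneg (x .g * σ .g))]

theorem integral_exp_logLaw (hρ : |ρ| ≤ 1) (μ : Fuel → ℝ) (p q : ℝ) :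
    ∫ y, Real.exp (p * y .c + q * y .g) ∂(logLaw μ σ ρ) = Real.exp (p * μ .c + q * μ .g
      + (p ^ 2 * σ .c ^ 2 + 2 * p * q * (ρ * σ .c * σ .g) + q ^ 2 * σ .g ^ 2) / 2) := by
  set v : EuclideanSpace ℝ Fuel := WithLp.toLp 2 (fun | .c => p | .g => q) with hv
  have hg : IsGaussian (logLaw μ σ ρ) := isGaussian_multivariateGaussian
  have hin : ∀ y : EuclideanSpace ℝ Fuel, innerSL ℝ v y = p * y .c + q * y .g := by
    intro y
    simp [hv, PiLp.inner_apply, BidCurves.sum_fuel, mul_comm]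
  have hvar : Var[innerSL ℝ v; logLaw μ σ ρ]
      = p ^ 2 * σ .c ^ 2 + 2 * p * q * (ρ * σ .c * σ .g) + q ^ 2 * σ .g ^ 2 := by
    have h1 := covarianceBilin_self (μ := logLaw μ σ ρ) IsGaussian.memLp_two_id v
    have h2 : Var[innerSL ℝ v; logLaw μ σ ρ] = covarianceBilin (logLaw μ σ ρ) v v := h1.symm
    rw [h2, logLaw, covarianceBilin_multivariateGaussian (posSemidef_logCov hρ)]
    simp [Matrix.mulVec, dotProduct, BidCurves.sum_fuel, logCov, hv]
    ring
  have hmean : (logLaw μ σ ρ)[innerSL ℝ v] = p * μ .c + q * μ .g := by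
    rw [ContinuousLinearMap.integral_comp_id_comm IsGaussian.integrable_id, logLaw,
      integral_id_multivariateGaussian, hin]
  have hmgf := mgf_gaussianReal (IsGaussian.map_eq_gaussianReal (μ := logLaw μ σ ρ) (innerSL ℝ v)) 1
  rw [mgf, hmean, Real.coe_toNNReal _ (variance_nonneg _ _), hvar] at hmgf
  simp only [one_mul, hin] at hmgf
  rw [hmgf]
  congr 1
  ring

/-- The joint law of the log fuel prices and of demand. -/
def jointLaw (μ σ : Fuel → ℝ) (ρ μd σd : ℝ) : Measure (EuclideanSpace ℝ Fuel × ℝ) :=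
  (logLaw μ σ ρ).prod (gaussianReal μd (Real.toNNReal (σd ^ 2)))

instance (μ σ : Fuel → ℝ) (ρ : ℝ) : IsProbabilityMeasure (logLaw μ σ ρ) := by
  unfold logLaw
  infer_instance

instance (μ σ : Fuel → ℝ) (ρ μd σd : ℝ) : IsProbabilityMeasure (jointLaw μ σ ρ μd σd) := by
  unfold jointLaw
  infer_instance

/-- The logarithm of the exponential moment of the joint law. -/
def logMoment (μ σ : Fuel → ℝ) (ρ μd σd p q l : ℝ) : ℝ :=
  p * μ .c + q * μ .g + l * μd
    + (p ^ 2 * σ .c ^ 2 + 2 * p * q * (ρ * σ .c * σ .g) + q ^ 2 * σ .g ^ 2 + l ^ 2 * σd ^ 2) / 2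

theorem integral_exp_jointLaw (hρ : |ρ| ≤ 1) (μ : Fuel → ℝ) (μd σd p q l : ℝ) :
    ∫ z, Real.exp (p * z.1 .c + q * z.1 .g + l * z.2) ∂(jointLaw μ σ ρ μd σd)
      = Real.exp (logMoment μ σ ρ μd σd p q l) := by
  simp_rw [Real.exp_add _ (l * _)]
  rw [jointLaw, integral_prod_mul (fun y : EuclideanSpace ℝ Fuel => Real.exp (p * y .c + q * y .g))
    (fun x => Real.exp (l * x)), integral_exp_logLaw hρ]
  have h := congrFun (mgf_id_gaussianReal (μ := μd) (v := Real.toNNReal (σd ^ 2))) l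
  rw [mgf, Real.coe_toNNReal _ (sq_nonneg σd)] at h
  simp only [id] at h
  rw [h, ← Real.exp_add, logMoment]
  congr 1
  ring

end LogLaw

theorem measurable_ind {Z : Type*} [MeasurableSpace Z] {p : Z → Prop} [DecidablePred p]
    (hp : MeasurableSet {z | p z}) : Measurable fun z => ind (p z) :=
  Measurable.ite hp measurable_const measurable_const

theorem norm_ind_le (p : Prop) [Decidable p] : ‖ind p‖ ≤ 1 := by
  unfold ind
  split_ifs <;> simp

theorem ind_mul_ind (p q : Prop) [Decidable p] [Decidable q] :
    ind p * ind q = ind (p ∧ q) := by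
  unfold ind
  by_cases hp : p <;> by_cases hq : q <;> simp [hp, hq]

theorem indicator_one_eq_ind {Z : Type*} (p : Z → Prop) [DecidablePred p] (z : Z) :
    {z | p z}.indicator (1 : Z → ℝ) z = ind (p z) := by
  by_cases h : p z <;> simp [ind, h]

section Terms

variable {μ σ : Fuel → ℝ} {ρ μd σd : ℝ}

/-- The exponential of a linear combination of the log fuel prices and of demand. -/
def expLin (p q l : ℝ) (z : EuclideanSpace ℝ Fuel × ℝ) : ℝ :=
  Real.exp (p * z.1 .c + q * z.1 .g + l * z.2)

theorem integrable_expLin (hρ : |ρ| ≤ 1) (p q l : ℝ) :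
    Integrable (expLin p q l) (jointLaw μ σ ρ μd σd) :=
  integrable_exp_of_integral_eq (integral_exp_jointLaw hρ μ μd σd p q l)

theorem integrable_expLin_mul (hρ : |ρ| ≤ 1) (p q l : ℝ)
    {f : EuclideanSpace ℝ Fuel × ℝ → ℝ} (hf : Measurable f) {C : ℝ} (hC : ∀ z, ‖f z‖ ≤ C) :
    Integrable (fun z => expLin p q l z * f z) (jointLaw μ σ ρ μd σd) :=
  (integrable_expLin hρ p q l).mul_bdd hf.aestronglyMeasurable (.of_forall hC)

/-- The half space in which the spread of the log prices is small compared with demand. -/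
def spreadLe (e d y : ℝ) (z : EuclideanSpace ℝ Fuel × ℝ) : ℝ :=
  ind (e * (z.1 .g - z.1 .c) + d * z.2 ≤ y)

theorem measurable_spreadLe (e d y : ℝ) : Measurable (spreadLe e d y) :=
  measurable_ind (measurableSet_le (by fun_prop) measurable_const)

/-- The mean of the spread of the log prices after a change of measure. -/
def spreadMean (μ σ : Fuel → ℝ) (ρ p q : ℝ) : ℝ :=
  μ .g - μ .c + p * (ρ * σ .c * σ .g - σ .c ^ 2) + q * (σ .g ^ 2 - ρ * σ .c * σ .g)

theorem integral_expLin_mul_ind (hρ : |ρ| ≤ 1) (hσd : 0 < σd) (hv : 0 < volSq σ ρ)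
    {e : ℝ} (he : e ^ 2 = 1) (p q l d a y : ℝ) :
    ∫ z, expLin p q l z * (ind (z.2 ≤ a) * spreadLe e d y z) ∂(jointLaw μ σ ρ μd σd)
      = Real.exp (logMoment μ σ ρ μd σd p q l)
        * Phi2 ((a - (μd + l * σd ^ 2)) / σd)
            ((y - (e * spreadMean μ σ ρ p q + d * (μd + l * σd ^ 2)))
              / √(d ^ 2 * σd ^ 2 + volSq σ ρ))
            (d * σd / √(d ^ 2 * σd ^ 2 + volSq σ ρ)) := by
  have hs : √(σd ^ 2) = σd := Real.sqrt_sq hσd.le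
  have hw : 0 < d ^ 2 * σd ^ 2 + volSq σ ρ := by positivity
  have hw' : 0 < √(d ^ 2 * σd ^ 2 + volSq σ ρ) := Real.sqrt_pos.2 hw
  have key := integral_exp_mul_indicator_le_le (G := jointLaw μ σ ρ μd σd)
    (ℓ := fun z => p * z.1 .c + q * z.1 .g + l * z.2) (f := fun z => z.2)
    (g := fun z => e * (z.1 .g - z.1 .c) + d * z.2) (a := logMoment μ σ ρ μd σd p q l)
    (m₁ := μd + l * σd ^ 2) (m₂ := e * spreadMean μ σ ρ p q + d * (μd + l * σd ^ 2))
    (v₁ := σd ^ 2) (v₂ := d ^ 2 * σd ^ 2 + volSq σ ρ) (c := d * σd ^ 2)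
    (by fun_prop) (by fun_prop) (by positivity) hw ?_ ?_ a y
  · rw [hs] at key
    rw [show d * σd / √(d ^ 2 * σd ^ 2 + volSq σ ρ)
      = d * σd ^ 2 / (σd * √(d ^ 2 * σd ^ 2 + volSq σ ρ)) by field_simp, ← key]
    refine integral_congr_ae (.of_forall fun z => ?_)
    simp only [expLin, spreadLe, ind_mul_ind, indicator_one_eq_ind]
  · nlinarith [mul_pos (pow_pos hσd 2) hv]
  · intro s t
    have h := integral_exp_jointLaw (σ := σ) hρ μ μd σd (p - t * e) (q + t * e) (l + s + t * d)
    refine Eq.trans (integral_congr_ae (.of_forall fun z => ?_)) (h.trans ?_)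
    · dsimp only
      congr 1
      ring
    · congr 1
      simp only [logMoment, spreadMean, volSq]
      linear_combination (t ^ 2 / 2 * (σ .c ^ 2 - 2 * ρ * σ .c * σ .g + σ .g ^ 2)) * he

theorem measurable_netCount {n : ℕ} (a : Matrix (Fin 2) (Fin n) ℝ) : Measurable (netCount a) := by
  unfold netCount
  refine Finset.measurable_sum _ fun i _ => Measurable.sub ?_ ?_ <;>
    exact measurable_ind (measurableSet_le measurable_id measurable_const)

theorem norm_netCount_le {n : ℕ} (a : Matrix (Fin 2) (Fin n) ℝ) (x : ℝ) :
    ‖netCount a x‖ ≤ n * 2 := by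
  refine (norm_sum_le _ _).trans ((Finset.sum_le_sum fun i _ => (norm_sub_le _ _).trans
    (add_le_add (norm_ind_le _) (norm_ind_le _))).trans (le_of_eq ?_))
  simp
  ring

theorem integrable_expLin_mul_netCount (hρ : |ρ| ≤ 1) {n : ℕ} (a : Matrix (Fin 2) (Fin n) ℝ)
    (p q l e d y : ℝ) :
    Integrable (fun z => expLin p q l z * (netCount a z.2 * spreadLe e d y z))
      (jointLaw μ σ ρ μd σd) := by
  refine integrable_expLin_mul hρ p q l (C := n * 2 * 1)
    (((measurable_netCount a).comp measurable_snd).mul (measurable_spreadLe e d y)) fun z => ?_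
  rw [norm_mul]
  exact mul_le_mul (norm_netCount_le a _) (norm_ind_le _) (norm_nonneg _) (by positivity)

theorem integral_expLin_mul_netCount (hρ : |ρ| ≤ 1) (hσd : 0 < σd) (hv : 0 < volSq σ ρ)
    {e : ℝ} (he : e ^ 2 = 1) {n : ℕ} (a : Matrix (Fin 2) (Fin n) ℝ) (p q l d y : ℝ) :
    ∫ z, expLin p q l z * (netCount a z.2 * spreadLe e d y z) ∂(jointLaw μ σ ρ μd σd)
      = Real.exp (logMoment μ σ ρ μd σd p q l)
        * Phi2n (Matrix.of fun i j => (a i j - (μd + l * σd ^ 2)) / σd)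
            ((y - (e * spreadMean μ σ ρ p q + d * (μd + l * σd ^ 2)))
              / √(d ^ 2 * σd ^ 2 + volSq σ ρ))
            (d * σd / √(d ^ 2 * σd ^ 2 + volSq σ ρ)) := by
  have hint : ∀ b : ℝ, Integrable (fun z => expLin p q l z * (ind (z.2 ≤ b) * spreadLe e d y z))
      (jointLaw μ σ ρ μd σd) := by
    intro b
    refine integrable_expLin_mul hρ p q l (C := 1 * 1)
      ((measurable_ind (measurableSet_le measurable_snd measurable_const)).mul
        (measurable_spreadLe e d y)) fun z => ?_
    rw [norm_mul]
    exact mul_le_mul (norm_ind_le _) (norm_ind_le _) (norm_nonneg _) zero_le_one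
  have hsum : ∀ z : EuclideanSpace ℝ Fuel × ℝ,
      expLin p q l z * (netCount a z.2 * spreadLe e d y z)
        = ∑ i, (expLin p q l z * (ind (z.2 ≤ a 0 i) * spreadLe e d y z)
          - expLin p q l z * (ind (z.2 ≤ a 1 i) * spreadLe e d y z)) := by
    intro z
    rw [netCount, Finset.sum_mul, Finset.mul_sum]
    exact Finset.sum_congr rfl fun i _ => by ring
  simp_rw [hsum]
  have hsub : ∀ i, Integrable (fun z => expLin p q l z * (ind (z.2 ≤ a 0 i) * spreadLe e d y z)
      - expLin p q l z * (ind (z.2 ≤ a 1 i) * spreadLe e d y z)) (jointLaw μ σ ρ μd σd) :=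
    fun i => (hint _).sub (hint _)
  rw [integral_finsetSum _ fun i _ => hsub i, Phi2n, Finset.mul_sum]
  refine Finset.sum_congr rfl fun i _ => ?_
  rw [integral_sub (hint _) (hint _), integral_expLin_mul_ind hρ hσd hv he,
    integral_expLin_mul_ind hρ hσd hv he, ← mul_sub]
  rfl

theorem integral_expLin_mul_ind_demand (hρ : |ρ| ≤ 1) (hσd : 0 < σd) (p q l a : ℝ) :
    ∫ z, expLin p q l z * ind (z.2 ≤ a) ∂(jointLaw μ σ ρ μd σd)
      = Real.exp (logMoment μ σ ρ μd σd p q l) * Phi1 ((a - (μd + l * σd ^ 2)) / σd) := by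
  have key := integral_exp_mul_indicator_le (G := jointLaw μ σ ρ μd σd)
    (ℓ := fun z => p * z.1 .c + q * z.1 .g + l * z.2) (f := fun z => z.2)
    (a := logMoment μ σ ρ μd σd p q l) (m₁ := μd + l * σd ^ 2)
    (v₁ := σd ^ 2) (by fun_prop) (by positivity) ?_ a
  · rw [Real.sqrt_sq hσd.le] at key
    rw [← key]
    refine integral_congr_ae (.of_forall fun z => ?_)
    simp only [expLin, indicator_one_eq_ind]
  · intro s
    have h := integral_exp_jointLaw (σ := σ) hρ μ μd σd p q (l + s)
    refine Eq.trans (integral_congr_ae (.of_forall fun z => ?_)) (h.trans ?_)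
    · dsimp only
      congr 1
      ring
    · congr 1
      simp only [logMoment]
      ring

theorem integral_expLin_mul_ind_ge (hρ : |ρ| ≤ 1) (hσd : 0 < σd) (hv : 0 < volSq σ ρ)
    {e : ℝ} (he : e ^ 2 = 1) (p q a y : ℝ) :
    ∫ z, expLin p q 0 z * (ind (a ≤ z.2) * spreadLe e 0 y z) ∂(jointLaw μ σ ρ μd σd)
      = Real.exp (logMoment μ σ ρ μd σd p q 0)
        * (Phi1 (-((a - μd) / σd))
          * Phi1 ((y - e * spreadMean μ σ ρ p q) / √(volSq σ ρ))) := by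
  have h1 := integral_exp_mul_indicator_le (G := logLaw μ σ ρ)
    (ℓ := fun z => p * z .c + q * z .g) (f := fun z => e * (z .g - z .c))
    (a := logMoment μ σ ρ μd σd p q 0) (m₁ := e * spreadMean μ σ ρ p q)
    (v₁ := volSq σ ρ) (by fun_prop) hv ?_ y
  · have h2 := integral_exp_mul_indicator_le (G := gaussianReal μd (Real.toNNReal (σd ^ 2)))
      (ℓ := fun _ => 0) (f := fun x => -x) (a := 0) (m₁ := -μd)
      (v₁ := σd ^ 2) (by fun_prop) (by positivity) ?_ (-a)
    · rw [Real.sqrt_sq hσd.le] at h2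
      simp only [Real.exp_zero, one_mul] at h2
      rw [show -((a - μd) / σd) = (-a - -μd) / σd by ring, ← h2, mul_comm (integral _ _), ← mul_assoc,
        ← h1, ← integral_prod_mul]
      refine integral_congr_ae (.of_forall fun z => ?_)
      simp only [expLin, spreadLe, indicator_one_eq_ind, zero_mul, add_zero, neg_le_neg_iff]
      ring
    · intro s
      have h := congrFun (mgf_id_gaussianReal (μ := μd) (v := Real.toNNReal (σd ^ 2))) (-s)
      rw [mgf, Real.coe_toNNReal _ (sq_nonneg σd)] at h
      simp only [id] at h
      refine Eq.trans (integral_congr_ae (.of_forall fun z => ?_)) (h.trans ?_)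
      · dsimp only
        congr 1
        ring
      · congr 1
        ring
  · intro s
    have h := integral_exp_logLaw (σ := σ) hρ μ (p - s * e) (q + s * e)
    refine Eq.trans (integral_congr_ae (.of_forall fun z => ?_)) (h.trans ?_)
    · dsimp only
      congr 1
      ring
    · congr 1
      simp only [logMoment, spreadMean, volSq]
      linear_combination (s ^ 2 / 2 * (σ .c ^ 2 - 2 * ρ * σ .c * σ .g + σ .g ^ 2)) * he

theorem ae_spread_ne (hρ : |ρ| ≤ 1) (hv : 0 < volSq σ ρ) (d y : ℝ) :
    ∀ᵐ z ∂(jointLaw μ σ ρ μd σd), z.1 .g - z.1 .c + d * z.2 ≠ y := by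
  refine ae_ne_of_mgf (m₁ := spreadMean μ σ ρ 0 0 + d * μd)
    (v₁ := d ^ 2 * σd ^ 2 + volSq σ ρ) (by fun_prop) (by positivity) (fun s => ?_) y
  have h := integral_exp_jointLaw (σ := σ) hρ μ μd σd (-s) s (s * d)
  refine Eq.trans (integral_congr_ae (.of_forall fun z => ?_)) (h.trans ?_)
  · dsimp only
    congr 1
    ring
  · congr 1
    simp only [logMoment, spreadMean, volSq]
    ring

theorem ae_demand_ne (hρ : |ρ| ≤ 1) (hσd : 0 < σd) (x : ℝ) :
    ∀ᵐ z ∂(jointLaw μ σ ρ μd σd), z.2 ≠ x := by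
  refine ae_ne_of_mgf (m₁ := μd) (v₁ := σd ^ 2) (by fun_prop) (by positivity) (fun s => ?_) x
  have h := integral_exp_jointLaw (σ := σ) hρ μ μd σd 0 0 s
  refine Eq.trans (integral_congr_ae (.of_forall fun z => ?_)) (h.trans ?_)
  · dsimp only
    congr 1
    ring
  · congr 1
    simp only [logMoment]
    ring

end Terms

theorem ind_congr {p q : Prop} [Decidable p] [Decidable q] (h : p ↔ q) : ind p = ind q := by
  unfold ind
  simp [h]

theorem one_sub_ind_le {a b : ℝ} (h : b ≠ a) : 1 - ind (a ≤ b) = ind (b ≤ a) := by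
  rcases h.lt_or_gt with h | h
  · rw [ind_false (not_le.2 h), ind_true h.le]
    ring
  · rw [ind_false (not_le.2 h), ind_true h.le]
    ring

namespace BidCurves

variable {B : BidCurves} {y : Fuel → ℝ} {x h : ℝ}

theorem le_coalShare_iff {t : ℝ} : t ≤ B.coalShare y x ↔
    -1 * (y .g - y .c) + -B.m .g * x ≤ B.k .g - B.k .c - (B.m .g + B.m .c) * t := by
  have := add_pos (B.m_pos .c) (B.m_pos .g)
  rw [coalShare, le_div_iff₀ this]
  constructor <;> intro h <;> linarith

theorem coalShare_le_iff {t : ℝ} : B.coalShare y x ≤ t ↔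
    1 * (y .g - y .c) + B.m .g * x ≤ B.k .c - B.k .g + (B.m .g + B.m .c) * t := by
  have := add_pos (B.m_pos .c) (B.m_pos .g)
  rw [coalShare, div_le_iff₀ this]
  constructor <;> intro h <;> linarith

theorem coalShare_ne {t : ℝ}
    (h : y .g - y .c + B.m .g * x ≠ B.k .c - B.k .g + (B.m .g + B.m .c) * t) :
    B.coalShare y x ≠ t := by
  have := add_pos (B.m_pos .c) (B.m_pos .g)
  contrapose! h
  rw [coalShare, div_eq_iff this.ne'] at h
  linarith

theorem exp_coalShare (z : EuclideanSpace ℝ Fuel × ℝ) :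
    Real.exp (z.1 .c + B.k .c + B.m .c * B.coalShare z.1 z.2)
      = Real.exp B.beta * expLin (B.alpha .c) (B.alpha .g) B.gamma z := by
  have := B.m_pos .c
  have := B.m_pos .g
  rw [expLin, ← Real.exp_add]
  congr 1
  simp only [coalShare, beta, alpha, gamma, Fuel.other]
  field_simp
  ring

variable {μ σ : Fuel → ℝ} {ρ μd σd : ℝ}

theorem payoff_ae_eq (hρ : |ρ| ≤ 1) (hσd : 0 < σd) (hv : 0 < volSq σ ρ)
    (hh : 0 < h) (h0 : 0 ≤ B.xiH h) (hc : B.xiH h ≤ B.cap .c) :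
    ∀ᵐ z ∂(jointLaw μ σ ρ μd σd), B.payoff h (expPrice z.1) z.2 =
      Real.exp (B.k .c) * (expLin 1 0 (B.m .c) z
        * (netCount !![B.cap .c, B.level h 2; B.level h 3, B.level h 1] z.2
          * spreadLe (-1) (B.m .c) (B.k .g - B.k .c) z))
      + Real.exp (B.k .c - B.m .c * B.cap .g) * (expLin 1 0 (B.m .c) z
        * (netCount !![B.level h 7, B.level h 5; B.level h 6, B.level h 4] z.2
          * spreadLe 1 (-B.m .c)
            (B.k .c - B.k .g - B.m .c * B.cap .g - B.m .g * B.cap .g) z))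
      + Real.exp (B.k .g - B.m .g * B.cap .c) * (expLin 0 1 (B.m .g) z
        * (netCount !![B.level h 7; B.cap .c] z.2
          * spreadLe (-1) (-B.m .g) (B.k .g - B.k .c - (B.m .g + B.m .c) * B.cap .c) z))
      - h * (expLin 1 0 0 z
        * (netCount !![B.level h 6, B.level h 4, B.level h 2;
            B.level h 5, B.level h 3, B.level h 1] z.2
          * spreadLe (-1) (-B.m .g) (B.k .g - B.k .c - (B.m .g + B.m .c) * B.xiH h) z))
      + Real.exp B.beta * (expLin (B.alpha .c) (B.alpha .g) B.gamma z
        * (netCount !![B.cap .c, B.level h 2; B.level h 3, B.level h 1] z.2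
          * spreadLe 1 (-B.m .c) (B.k .c - B.k .g) z))
      - Real.exp B.beta * (expLin (B.alpha .c) (B.alpha .g) B.gamma z
        * (netCount !![B.level h 7, B.level h 5; B.level h 6, B.level h 4] z.2
          * spreadLe 1 (-B.m .c)
            (B.k .c - B.k .g - B.m .c * B.cap .g - B.m .g * B.cap .g) z))
      + Real.exp B.beta * (expLin (B.alpha .c) (B.alpha .g) B.gamma z
        * (netCount !![B.level h 7; B.cap .c] z.2
          * spreadLe 1 (B.m .g) (B.k .c - B.k .g + (B.m .g + B.m .c) * B.cap .c) z))
      - Real.exp B.beta * (expLin (B.alpha .c) (B.alpha .g) B.gamma z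
        * (netCount !![B.level h 6, B.level h 4, B.level h 2;
            B.level h 5, B.level h 3, B.level h 1] z.2
          * spreadLe 1 (B.m .g) (B.k .c - B.k .g + (B.m .g + B.m .c) * B.xiH h) z))
      + Real.exp (B.k .c + B.m .c * B.cap .c) * (expLin 1 0 0 z
        * (ind (B.totalCap ≤ z.2)
          * spreadLe 1 0 (B.k .c + B.m .c * B.cap .c - B.k .g - B.m .g * B.cap .g) z))
      + Real.exp (B.k .g + B.m .g * B.cap .g) * (expLin 0 1 0 z
        * (ind (B.totalCap ≤ z.2)
          * spreadLe (-1) 0 (B.k .g + B.m .g * B.cap .g - B.k .c - B.m .c * B.cap .c) z))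
      - h * (expLin 1 0 0 z
        * (1 - ind (z.2 ≤ B.level h 6) + ind (z.2 ≤ B.level h 5) - ind (z.2 ≤ B.level h 4))) := by
  filter_upwards [ae_demand_ne (μ := μ) (μd := μd) hρ hσd B.totalCap,
    ae_spread_ne hρ hv (-B.m .c) (B.k .c - B.k .g),
    ae_spread_ne hρ hv (B.m .g) (B.k .c - B.k .g + (B.m .g + B.m .c) * B.cap .c),
    ae_spread_ne hρ hv (B.m .g) (B.k .c - B.k .g + (B.m .g + B.m .c) * B.xiH h),
    ae_spread_ne hρ hv 0 (B.k .c + B.m .c * B.cap .c - B.k .g - B.m .g * B.cap .g)]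
    with z n1 n2 n3 n4 n5
  have hne : B.coalShare z.1 z.2 ≠ z.2 := by
    refine coalShare_ne fun h => n2 ?_
    linarith
  have hne' : z.1 .c + B.k .c + B.m .c * B.cap .c ≠ z.1 .g + B.k .g + B.m .g * B.cap .g := by
    contrapose! n5
    linarith
  have i1 : ind (z.2 ≤ B.coalShare z.1 z.2) = spreadLe (-1) (B.m .c) (B.k .g - B.k .c) z := by
    refine ind_congr (le_coalShare_iff.trans ?_)
    constructor <;> intro h <;> linarith
  have i2 : ind (B.coalShare z.1 z.2 ≤ z.2 - B.cap .g) = spreadLe 1 (-B.m .c)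
      (B.k .c - B.k .g - B.m .c * B.cap .g - B.m .g * B.cap .g) z := by
    refine ind_congr (coalShare_le_iff.trans ?_)
    constructor <;> intro h <;> linarith
  have i3 : ∀ t, ind (t ≤ B.coalShare z.1 z.2)
      = spreadLe (-1) (-B.m .g) (B.k .g - B.k .c - (B.m .g + B.m .c) * t) z :=
    fun t => ind_congr le_coalShare_iff
  have i4 : ∀ t, ind (B.coalShare z.1 z.2 ≤ t)
      = spreadLe 1 (B.m .g) (B.k .c - B.k .g + (B.m .g + B.m .c) * t) z :=
    fun t => ind_congr coalShare_le_iff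
  have i5 : ind (B.coalShare z.1 z.2 ≤ z.2) = spreadLe 1 (-B.m .c) (B.k .c - B.k .g) z := by
    refine ind_congr (coalShare_le_iff.trans ?_)
    constructor <;> intro h <;> linarith
  have i6 : ind (z.1 .g + B.k .g + B.m .g * B.cap .g ≤ z.1 .c + B.k .c + B.m .c * B.cap .c)
      = spreadLe 1 0 (B.k .c + B.m .c * B.cap .c - B.k .g - B.m .g * B.cap .g) z := by
    refine ind_congr ?_
    constructor <;> intro h <;> linarith
  have i7 : ind (z.1 .c + B.k .c + B.m .c * B.cap .c ≤ z.1 .g + B.k .g + B.m .g * B.cap .g)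
      = spreadLe (-1) 0 (B.k .g + B.m .g * B.cap .g - B.k .c - B.m .c * B.cap .c) z := by
    refine ind_congr ?_
    constructor <;> intro h <;> linarith
  have e1 : Real.exp (z.1 .c + B.k .c + B.m .c * z.2)
      = Real.exp (B.k .c) * expLin 1 0 (B.m .c) z := by
    rw [expLin, ← Real.exp_add]
    ring_nf
  have e2 : Real.exp (z.1 .c + B.k .c + B.m .c * (z.2 - B.cap .g))
      = Real.exp (B.k .c - B.m .c * B.cap .g) * expLin 1 0 (B.m .c) z := by
    rw [expLin, ← Real.exp_add]
    ring_nf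
  have e3 : Real.exp (z.1 .g + B.k .g + B.m .g * (z.2 - B.cap .c))
      = Real.exp (B.k .g - B.m .g * B.cap .c) * expLin 0 1 (B.m .g) z := by
    rw [expLin, ← Real.exp_add]
    ring_nf
  have e4 : Real.exp (z.1 .c + B.k .c + B.m .c * B.xiH h) = h * expLin 1 0 0 z := by
    rw [← mul_expPrice_coal hh, expPrice, expLin]
    ring_nf
  have e5 : Real.exp (z.1 .c + B.k .c + B.m .c * B.cap .c)
      = Real.exp (B.k .c + B.m .c * B.cap .c) * expLin 1 0 0 z := by
    rw [expLin, ← Real.exp_add]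
    ring_nf
  have e6 : Real.exp (z.1 .g + B.k .g + B.m .g * B.cap .g)
      = Real.exp (B.k .g + B.m .g * B.cap .g) * expLin 0 1 0 z := by
    rw [expLin, ← Real.exp_add]
    ring_nf
  rw [payoff_expPrice hh h0 hc n1, one_sub_ind_le hne, one_sub_ind_le (coalShare_ne n3),
    one_sub_ind_le (coalShare_ne n4), one_sub_ind_le hne', i1, i2, i5, i3, i3, i4, i4, i6, i7,
    e1, e2, e3, e4, e5, e6, exp_coalShare]
  ring

theorem integral_expLin_mul_level (hρ : |ρ| ≤ 1) (hσd : 0 < σd) (a b c : ℝ) :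
    Integrable (fun z => expLin 1 0 0 z * (1 - ind (z.2 ≤ a) + ind (z.2 ≤ b) - ind (z.2 ≤ c)))
        (jointLaw μ σ ρ μd σd) ∧
      ∫ z, expLin 1 0 0 z * (1 - ind (z.2 ≤ a) + ind (z.2 ≤ b) - ind (z.2 ≤ c))
        ∂(jointLaw μ σ ρ μd σd)
      = Real.exp (logMoment μ σ ρ μd σd 1 0 0)
        * (1 - Phi1 ((a - μd) / σd) + Phi1 ((b - μd) / σd) - Phi1 ((c - μd) / σd)) := by
  have hint : ∀ t : ℝ, Integrable (fun z => expLin 1 0 0 z * ind (z.2 ≤ t))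
      (jointLaw μ σ ρ μd σd) := fun t =>
    integrable_expLin_mul hρ 1 0 0 (measurable_ind (measurableSet_le measurable_snd
      measurable_const)) fun z => norm_ind_le _
  have h1 : Integrable (fun z => expLin 1 0 0 z - expLin 1 0 0 z * ind (z.2 ≤ a))
    (jointLaw μ σ ρ μd σd) := (integrable_expLin hρ 1 0 0).sub (hint a)
  have h2 : Integrable (fun z => expLin 1 0 0 z - expLin 1 0 0 z * ind (z.2 ≤ a)
    + expLin 1 0 0 z * ind (z.2 ≤ b)) (jointLaw μ σ ρ μd σd) := h1.add (hint b)
  have e : ∀ z : EuclideanSpace ℝ Fuel × ℝ,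
      expLin 1 0 0 z * (1 - ind (z.2 ≤ a) + ind (z.2 ≤ b) - ind (z.2 ≤ c))
        = expLin 1 0 0 z - expLin 1 0 0 z * ind (z.2 ≤ a) + expLin 1 0 0 z * ind (z.2 ≤ b)
          - expLin 1 0 0 z * ind (z.2 ≤ c) := fun z => by ring
  simp_rw [e]
  refine ⟨h2.sub (hint c), ?_⟩
  rw [integral_sub h2 (hint c), integral_add h1 (hint b),
    integral_sub (integrable_expLin hρ 1 0 0) (hint a),
    integral_expLin_mul_ind_demand hρ hσd, integral_expLin_mul_ind_demand hρ hσd,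
    integral_expLin_mul_ind_demand hρ hσd]
  have h3 : ∫ z, expLin 1 0 0 z ∂(jointLaw μ σ ρ μd σd)
      = Real.exp (logMoment μ σ ρ μd σd 1 0 0) := integral_exp_jointLaw hρ μ μd σd 1 0 0
  rw [h3]
  ring_nf

end BidCurves

/-- The function `f` is integrable with integral `v`. -/
def HasMean {Z : Type*} {mZ : MeasurableSpace Z} (G : Measure Z) (f : Z → ℝ) (v : ℝ) : Prop :=
  Integrable f G ∧ ∫ z, f z ∂G = v

namespace HasMean

variable {Z : Type*} {mZ : MeasurableSpace Z} {G : Measure Z} {f g : Z → ℝ} {v w : ℝ}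

theorem add (hf : HasMean G f v) (hg : HasMean G g w) :
    HasMean G (fun z => f z + g z) (v + w) :=
  ⟨hf.1.add hg.1, by rw [integral_add hf.1 hg.1, hf.2, hg.2]⟩

theorem sub (hf : HasMean G f v) (hg : HasMean G g w) :
    HasMean G (fun z => f z - g z) (v - w) :=
  ⟨hf.1.sub hg.1, by rw [integral_sub hf.1 hg.1, hf.2, hg.2]⟩

theorem const_mul (c : ℝ) (hf : HasMean G f v) : HasMean G (fun z => c * f z) (c * v) :=
  ⟨hf.1.const_mul c, by rw [integral_const_mul, hf.2]⟩

end HasMean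

/-- The forward prices for log fuel prices with means `μ` and standard deviations `σ`. -/
def lognormalMean (μ σ : Fuel → ℝ) : Fuel → ℝ := fun i => Real.exp (μ i + σ i ^ 2 / 2)

theorem shift_two (a b c d μ s l : ℝ) (hs : 0 < s) :
    (Matrix.of fun i j => (!![a, b; c, d] i j - (μ + l * s ^ 2)) / s)
      = shift (l * s) !![(a - μ) / s, (b - μ) / s; (c - μ) / s, (d - μ) / s] := by
  ext i j
  fin_cases i <;> fin_cases j <;> simp [shift] <;> field_simp <;> ring

theorem shift_one (a b μ s l : ℝ) (hs : 0 < s) :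
    (Matrix.of fun i j => (!![a; b] i j - (μ + l * s ^ 2)) / s)
      = shift (l * s) !![(a - μ) / s; (b - μ) / s] := by
  ext i j
  fin_cases i <;> fin_cases j <;> simp [shift] <;> field_simp <;> ring

theorem shift_three (a b c d e f μ s l : ℝ) (hs : 0 < s) :
    (Matrix.of fun i j => (!![a, b, c; d, e, f] i j - (μ + l * s ^ 2)) / s)
      = shift (l * s) !![(a - μ) / s, (b - μ) / s, (c - μ) / s;
          (d - μ) / s, (e - μ) / s, (f - μ) / s] := by
  ext i j
  fin_cases i <;> fin_cases j <;> simp [shift] <;> field_simp <;> ring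

theorem shift_zero {n : ℕ} (a : Matrix (Fin 2) (Fin n) ℝ) : shift 0 a = a := by
  ext i j
  simp [shift]

namespace BidCurves

variable {B : BidCurves} {h : ℝ} {μ σ : Fuel → ℝ} {ρ μd σd : ℝ}

theorem gamma_eq : B.gamma = B.alpha .g * B.m .g := by
  simp only [gamma, alpha, Fuel.other]
  ring

theorem alpha_pos (i : Fuel) : 0 < B.alpha i :=
  div_pos (B.m_pos _) (add_pos (B.m_pos _) (B.m_pos _))

theorem gamma_div : B.gamma ^ 2 * σd ^ 2 / B.alpha .g ^ 2 = B.m .g ^ 2 * σd ^ 2 := by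
  have := B.alpha_pos .g
  rw [gamma_eq]
  field_simp

theorem exp_mul_logMoment_coal (c : ℝ) :
    Real.exp (B.k .c - B.m .c * c) * Real.exp (logMoment μ σ ρ μd σd 1 0 (B.m .c))
      = B.bid .c (μd - c) (lognormalMean μ σ .c) * Real.exp (B.m .c ^ 2 * σd ^ 2 / 2) := by
  simp only [bid, lognormalMean, logMoment, ← Real.exp_add]
  congr 1
  ring

theorem exp_mul_logMoment_gas (c : ℝ) :
    Real.exp (B.k .g - B.m .g * c) * Real.exp (logMoment μ σ ρ μd σd 0 1 (B.m .g))
      = B.bid .g (μd - c) (lognormalMean μ σ .g) * Real.exp (B.m .g ^ 2 * σd ^ 2 / 2) := by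
  simp only [bid, lognormalMean, logMoment, ← Real.exp_add]
  congr 1
  ring

theorem exp_logMoment_coal :
    Real.exp (logMoment μ σ ρ μd σd 1 0 0) = lognormalMean μ σ .c := by
  simp only [lognormalMean, logMoment]
  congr 1
  ring

theorem exp_logMoment_gas :
    Real.exp (logMoment μ σ ρ μd σd 0 1 0) = lognormalMean μ σ .g := by
  simp only [lognormalMean, logMoment]
  congr 1
  ring

theorem exp_mul_logMoment_both :
    Real.exp B.beta * Real.exp (logMoment μ σ ρ μd σd (B.alpha .c) (B.alpha .g) B.gamma)
      = B.bidBoth μd (lognormalMean μ σ)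
        * Real.exp ((B.gamma ^ 2 * σd ^ 2 - B.alpha .c * B.alpha .g * volSq σ ρ) / 2) := by
  have h1 : B.alpha .c = 1 - B.alpha .g := by
    have := B.m_pos .c
    have := B.m_pos .g
    simp only [alpha, Fuel.other]
    field_simp
    ring
  simp only [bidBoth, lognormalMean, ← Real.exp_mul, ← Real.exp_add, logMoment, volSq, h1]
  congr 1
  ring

theorem log_lognormalMean (i : Fuel) : Real.log (lognormalMean μ σ i) = μ i + σ i ^ 2 / 2 :=
  Real.log_exp _

theorem hasMean_netCount (hρ : |ρ| ≤ 1) (hσd : 0 < σd) (hv : 0 < volSq σ ρ)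
    {e : ℝ} (he : e ^ 2 = 1) {n : ℕ} (a : Matrix (Fin 2) (Fin n) ℝ) (p q l d y : ℝ) (c : ℝ)
    {C Y r s : ℝ} {a' : Matrix (Fin 2) (Fin n) ℝ}
    (hC : c * Real.exp (logMoment μ σ ρ μd σd p q l) = C)
    (ha : (Matrix.of fun i j => (a i j - (μd + l * σd ^ 2)) / σd) = a')
    (hs : √(d ^ 2 * σd ^ 2 + volSq σ ρ) = s)
    (hY : y - (e * spreadMean μ σ ρ p q + d * (μd + l * σd ^ 2)) = Y) (hr : d * σd / s = r) :
    HasMean (jointLaw μ σ ρ μd σd)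
      (fun z => c * (expLin p q l z * (netCount a z.2 * spreadLe e d y z)))
      (C * Phi2n a' (Y / s) r) := by
  have h1 : HasMean (jointLaw μ σ ρ μd σd)
      (fun z => expLin p q l z * (netCount a z.2 * spreadLe e d y z)) _ :=
    ⟨integrable_expLin_mul_netCount hρ a p q l e d y,
      integral_expLin_mul_netCount hρ hσd hv he a p q l d y⟩
  have h2 := h1.const_mul c
  rwa [ha, hs, hY, hr, ← mul_assoc, hC] at h2

theorem hasMean_demand_ge (hρ : |ρ| ≤ 1) (hσd : 0 < σd) (hv : 0 < volSq σ ρ)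
    {e : ℝ} (he : e ^ 2 = 1) (p q a y c : ℝ) {F Y : ℝ}
    (hC : Real.exp (logMoment μ σ ρ μd σd p q 0) = F)
    (hY : y - e * spreadMean μ σ ρ p q = Y) :
    HasMean (jointLaw μ σ ρ μd σd)
      (fun z => c * (expLin p q 0 z * (ind (a ≤ z.2) * spreadLe e 0 y z)))
      (c * (F * (Phi1 (-((a - μd) / σd)) * Phi1 (Y / √(volSq σ ρ))))) := by
  subst hC hY
  refine HasMean.const_mul c ⟨?_, integral_expLin_mul_ind_ge hρ hσd hv he p q a y⟩
  refine integrable_expLin_mul hρ p q 0 (C := 1 * 1)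
    ((measurable_ind (measurableSet_le measurable_const measurable_snd)).mul
      (measurable_spreadLe e 0 y)) fun z => ?_
  rw [norm_mul]
  exact mul_le_mul (norm_ind_le _) (norm_ind_le _) (norm_nonneg _) zero_le_one

theorem integral_payoff (hρ : |ρ| ≤ 1) (hσd : 0 < σd) (hv : 0 < volSq σ ρ)
    (hh : 0 < h) (h0 : 0 ≤ B.xiH h) (hc : B.xiH h ≤ B.cap .c) :
    ∫ z, B.payoff h (expPrice z.1) z.2 ∂(jointLaw μ σ ρ μd σd)
      = B.closedForm h σ ρ μd σd (lognormalMean μ σ) := by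
  have mc := B.m_pos .c
  have mg := B.m_pos .g
  have ag := B.alpha_pos .g
  have hsγ : √(B.m .g ^ 2 * σd ^ 2 + volSq σ ρ) ≠ 0 := by positivity
  rw [integral_congr_ae (payoff_ae_eq hρ hσd hv hh h0 hc)]
  have t1 := hasMean_netCount (μ := μ) (μd := μd) hρ hσd hv (e := -1) (by norm_num)
    !![B.cap .c, B.level h 2; B.level h 3, B.level h 1] 1 0 (B.m .c) (B.m .c) (B.k .g - B.k .c)
    (Real.exp (B.k .c)) (Y := B.R (volSq σ ρ) (lognormalMean μ σ) .c μd 0 - B.m .c ^ 2 * σd ^ 2)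
    (by simpa using exp_mul_logMoment_coal (B := B) (μ := μ) (σ := σ) (ρ := ρ) (μd := μd) (σd := σd) 0)
    (shift_two _ _ _ _ _ _ _ hσd) rfl
    (by simp only [R, spreadMean, volSq, log_lognormalMean, Fuel.other]; ring) rfl
  have t2 := hasMean_netCount (μ := μ) (μd := μd) hρ hσd hv (e := 1) (by norm_num)
    !![B.level h 7, B.level h 5; B.level h 6, B.level h 4] 1 0 (B.m .c) (-B.m .c)
    (B.k .c - B.k .g - B.m .c * B.cap .g - B.m .g * B.cap .g)
    (Real.exp (B.k .c - B.m .c * B.cap .g))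
    (Y := -B.R (volSq σ ρ) (lognormalMean μ σ) .c (μd - B.cap .g) (B.cap .g)
      + B.m .c ^ 2 * σd ^ 2)
    (exp_mul_logMoment_coal _) (shift_two _ _ _ _ _ _ _ hσd) (by rw [neg_sq])
    (by simp only [R, spreadMean, volSq, log_lognormalMean, Fuel.other]; ring)
    (by rw [neg_mul])
  have t3 := hasMean_netCount (μ := μ) (μd := μd) hρ hσd hv (e := -1) (by norm_num)
    !![B.level h 7; B.cap .c] 0 1 (B.m .g) (-B.m .g)
    (B.k .g - B.k .c - (B.m .g + B.m .c) * B.cap .c)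
    (Real.exp (B.k .g - B.m .g * B.cap .c))
    (Y := -B.R (volSq σ ρ) (lognormalMean μ σ) .g (μd - B.cap .c) (B.cap .c)
      + B.m .g ^ 2 * σd ^ 2)
    (exp_mul_logMoment_gas _) (shift_one _ _ _ _ _ hσd) (by rw [neg_sq])
    (by simp only [R, spreadMean, volSq, log_lognormalMean, Fuel.other]; ring)
    (by rw [neg_mul])
  have t4 := hasMean_netCount (μ := μ) (μd := μd) hρ hσd hv (e := -1) (by norm_num)
    !![B.level h 6, B.level h 4, B.level h 2; B.level h 5, B.level h 3, B.level h 1] 1 0 0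
    (-B.m .g) (B.k .g - B.k .c - (B.m .g + B.m .c) * B.xiH h) h
    (Y := Rt (volSq σ ρ) (lognormalMean μ σ) .c
      ((B.beta + B.gamma * μd - Real.log h) / B.alpha .g))
    (by rw [exp_logMoment_coal]) ((shift_three _ _ _ _ _ _ _ _ _ hσd).trans
      (by rw [zero_mul, shift_zero])) (by rw [neg_sq, ← gamma_div])
    (by
      simp only [Rt, spreadMean, volSq, log_lognormalMean, Fuel.other, xiH, beta, gamma, alpha]
      field_simp
      ring)
    (r := -(B.gamma * σd) / (B.alpha .g
      * √(B.gamma ^ 2 * σd ^ 2 / B.alpha .g ^ 2 + volSq σ ρ)))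
    (by
      rw [gamma_div, gamma_eq]
      field_simp)
  have t5 := hasMean_netCount (μ := μ) (μd := μd) hρ hσd hv (e := 1) (by norm_num)
    !![B.cap .c, B.level h 2; B.level h 3, B.level h 1] (B.alpha .c) (B.alpha .g) B.gamma
    (-B.m .c) (B.k .c - B.k .g) (Real.exp B.beta)
    (Y := -B.R (volSq σ ρ) (lognormalMean μ σ) .c μd 0 - B.alpha .g * volSq σ ρ
      + B.gamma * B.m .c * σd ^ 2)
    exp_mul_logMoment_both (shift_two _ _ _ _ _ _ _ hσd) (by rw [neg_sq])
    (by
      simp only [R, spreadMean, volSq, log_lognormalMean, Fuel.other, gamma, alpha]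
      field_simp
      ring)
    (by rw [neg_mul])
  have t6 := hasMean_netCount (μ := μ) (μd := μd) hρ hσd hv (e := 1) (by norm_num)
    !![B.level h 7, B.level h 5; B.level h 6, B.level h 4] (B.alpha .c) (B.alpha .g) B.gamma
    (-B.m .c) (B.k .c - B.k .g - B.m .c * B.cap .g - B.m .g * B.cap .g) (Real.exp B.beta)
    (Y := -B.R (volSq σ ρ) (lognormalMean μ σ) .c (μd - B.cap .g) (B.cap .g)
      - B.alpha .g * volSq σ ρ + B.gamma * B.m .c * σd ^ 2)
    exp_mul_logMoment_both (shift_two _ _ _ _ _ _ _ hσd) (by rw [neg_sq])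
    (by
      simp only [R, spreadMean, volSq, log_lognormalMean, Fuel.other, gamma, alpha]
      field_simp
      ring)
    (by rw [neg_mul])
  have t7 := hasMean_netCount (μ := μ) (μd := μd) hρ hσd hv (e := 1) (by norm_num)
    !![B.level h 7; B.cap .c] (B.alpha .c) (B.alpha .g) B.gamma
    (B.m .g) (B.k .c - B.k .g + (B.m .g + B.m .c) * B.cap .c) (Real.exp B.beta)
    (Y := B.R (volSq σ ρ) (lognormalMean μ σ) .g (μd - B.cap .c) (B.cap .c)
      + B.alpha .c * volSq σ ρ - B.gamma * B.m .g * σd ^ 2)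
    exp_mul_logMoment_both (shift_one _ _ _ _ _ hσd) rfl
    (by
      simp only [R, spreadMean, volSq, log_lognormalMean, Fuel.other, gamma, alpha]
      field_simp
      ring)
    rfl
  have t8 := hasMean_netCount (μ := μ) (μd := μd) hρ hσd hv (e := 1) (by norm_num)
    !![B.level h 6, B.level h 4, B.level h 2; B.level h 5, B.level h 3, B.level h 1]
    (B.alpha .c) (B.alpha .g) B.gamma
    (B.m .g) (B.k .c - B.k .g + (B.m .g + B.m .c) * B.xiH h) (Real.exp B.beta)
    (Y := -Rt (volSq σ ρ) (lognormalMean μ σ) .c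
      ((B.beta + B.gamma * μd - Real.log h) / B.alpha .g) - B.alpha .g * volSq σ ρ
      - B.gamma ^ 2 * σd ^ 2 / B.alpha .g)
    exp_mul_logMoment_both (shift_three _ _ _ _ _ _ _ _ _ hσd) (by rw [← gamma_div])
    (by
      simp only [Rt, spreadMean, volSq, log_lognormalMean, Fuel.other, xiH, beta, gamma, alpha]
      field_simp
      ring)
    (r := B.gamma * σd / (B.alpha .g
      * √(B.gamma ^ 2 * σd ^ 2 / B.alpha .g ^ 2 + volSq σ ρ)))
    (by
      rw [gamma_div, gamma_eq]
      field_simp)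
  have t9 := hasMean_demand_ge (μ := μ) (μd := μd) hρ hσd hv (e := 1) (by norm_num) 1 0
    B.totalCap (B.k .c + B.m .c * B.cap .c - B.k .g - B.m .g * B.cap .g)
    (Real.exp (B.k .c + B.m .c * B.cap .c))
    (Y := -B.R (volSq σ ρ) (lognormalMean μ σ) .c (B.cap .c) (B.cap .g)) exp_logMoment_coal
    (by simp only [R, spreadMean, volSq, log_lognormalMean, Fuel.other]; ring)
  have t10 := hasMean_demand_ge (μ := μ) (μd := μd) hρ hσd hv (e := -1) (by norm_num) 0 1
    B.totalCap (B.k .g + B.m .g * B.cap .g - B.k .c - B.m .c * B.cap .c)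
    (Real.exp (B.k .g + B.m .g * B.cap .g))
    (Y := -B.R (volSq σ ρ) (lognormalMean μ σ) .g (B.cap .g) (B.cap .c)) exp_logMoment_gas
    (by simp only [R, spreadMean, volSq, log_lognormalMean, Fuel.other]; ring)
  have t11 := HasMean.const_mul h (integral_expLin_mul_level (μ := μ) (μd := μd) (σ := σ) hρ hσd
    (B.level h 6) (B.level h 5) (B.level h 4))
  have total := ((((((((((t1.add t2).add t3).sub t4).add t5).sub t6).add t7).sub t8).add t9).add
    t10).sub t11)
  refine total.2.trans ?_
  rw [exp_logMoment_coal]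
  simp only [closedForm, sum_fuel, bid, Fuel.other]
  have h7 : B.level h 7 = B.totalCap := rfl
  rw [h7]
  ring

end BidCurves

section CondLaw

variable {Ω β E F : Type*} {mΩ : MeasurableSpace Ω} {mβ : MeasurableSpace β}
  [MeasurableSpace E] [MeasurableSpace F] {Q : Measure Ω} [IsProbabilityMeasure Q]

theorem map_eq_compProd_of_condExp {g : Ω → β} (hg : Measurable g) {Y : Ω → E} (hY : Measurable Y)
    {Z : Ω → F} (hZ : Measurable Z) (κ : Kernel β (E × F)) [IsMarkovKernel κ]
    (h : ∀ A B, MeasurableSet A → MeasurableSet B →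
      Q⟦Y ⁻¹' A ∩ Z ⁻¹' B | mβ.comap g⟧ =ᵐ[Q] fun ω => (κ (g ω)).real (A ×ˢ B)) :
    Q.map (fun ω => (g ω, (Y ω, Z ω))) = Q.map g ⊗ₘ κ := by
  have hp := Measure.isProbabilityMeasure_map (μ := Q) hg.aemeasurable
  refine Measure.ext_prod₃ fun {s A B} hs hA hB => ?_
  have hAB : MeasurableSet (Y ⁻¹' A ∩ Z ⁻¹' B) := (hY hA).inter (hZ hB)
  have hmeas : Measurable fun ω => κ (g ω) (A ×ˢ B) :=
    (Kernel.measurable_coe κ (hA.prod hB)).comp hg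
  rw [Measure.compProd_apply_prod hs (hA.prod hB), setLIntegral_map hs
    (Kernel.measurable_coe κ (hA.prod hB)) hg, Measure.map_apply (hg.prodMk (hY.prodMk hZ))
    (hs.prod (hA.prod hB))]
  have h1 : ∫ ω in g ⁻¹' s, (κ (g ω)).real (A ×ˢ B) ∂Q = Q.real (g ⁻¹' s ∩ (Y ⁻¹' A ∩ Z ⁻¹' B)) := by
    rw [← setIntegral_congr_ae (hg hs) ((h A B hA hB).mono fun ω hω _ => hω),
      setIntegral_condExp hg.comap_le ((integrable_const (1 : ℝ)).indicator hAB) ⟨s, hs, rfl⟩,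
      setIntegral_indicator hAB]
    simp
  have h2 : ∫⁻ ω in g ⁻¹' s, κ (g ω) (A ×ˢ B) ∂Q
      = ENNReal.ofReal (∫ ω in g ⁻¹' s, (κ (g ω)).real (A ×ˢ B) ∂Q) := by
    simp_rw [measureReal_def]
    rw [integral_toReal hmeas.aemeasurable (.of_forall fun ω => measure_lt_top _ _),
      ENNReal.ofReal_toReal]
    refine ne_of_lt ((lintegral_mono fun ω => prob_le_one).trans_lt ?_)
    simp
  rw [h2, h1, ofReal_measureReal]
  rfl

theorem condExp_comap_eq_integral [StandardBorelSpace E] [Nonempty E] [StandardBorelSpace F]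
    [Nonempty F] {g : Ω → β} (hg : Measurable g) {Y : Ω → E} (hY : Measurable Y)
    {Z : Ω → F} (hZ : Measurable Z) (κ : Kernel β (E × F)) [IsMarkovKernel κ]
    (h : ∀ A B, MeasurableSet A → MeasurableSet B →
      Q⟦Y ⁻¹' A ∩ Z ⁻¹' B | mβ.comap g⟧ =ᵐ[Q] fun ω => (κ (g ω)).real (A ×ˢ B))
    {f : E × F → ℝ} (hf : Measurable f) (hint : Integrable (fun ω => f (Y ω, Z ω)) Q) :
    Q[fun ω => f (Y ω, Z ω) | mβ.comap g] =ᵐ[Q] fun ω => ∫ z, f z ∂(κ (g ω)) := by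
  have h1 := condExp_ae_eq_integral_condDistrib hg (hY.prodMk hZ).aemeasurable
    hf.stronglyMeasurable hint
  have h2 := ae_of_ae_map hg.aemeasurable (condDistrib_ae_eq_of_measure_eq_compProd g
    (hY.prodMk hZ).aemeasurable (map_eq_compProd_of_condExp hg hY hZ κ h))
  filter_upwards [h1, h2] with ω h3 h4
  rw [h3, h4]

end CondLaw

theorem jointLaw_eq_map (μ σ : Fuel → ℝ) (ρ μd σd : ℝ) : jointLaw μ σ ρ μd σd
    = (jointLaw 0 σ ρ 0 σd).map (fun z => (WithLp.toLp 2 μ + z.1, μd + z.2)) := by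
  have h1 : logLaw μ σ ρ = (logLaw 0 σ ρ).map (fun y => WithLp.toLp 2 μ + y) := by
    rw [logLaw, logLaw, multivariateGaussian, multivariateGaussian, Measure.map_map (by fun_prop)
      (by fun_prop)]
    congr 1
    ext y i
    simp
  have h2 : gaussianReal μd (Real.toNNReal (σd ^ 2))
      = (gaussianReal 0 (Real.toNNReal (σd ^ 2))).map (fun x => μd + x) := by
    rw [gaussianReal_map_const_add, zero_add]
  rw [jointLaw, h1, h2, jointLaw, Measure.map_prod_map _ _ (by fun_prop) (by fun_prop)]
  rfl

/-- The conditional law of the log fuel prices and of demand, as a kernel. -/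
def jointKernel {Ω : Type*} [MeasurableSpace Ω] {μ : Fuel → Ω → ℝ} (hμ : ∀ i, Measurable (μ i))
    (σ : Fuel → ℝ) (ρ : ℝ) {μd : Ω → ℝ} (hμd : Measurable μd) (σd : ℝ) :
    Kernel Ω (EuclideanSpace ℝ Fuel × ℝ) where
  toFun ω := jointLaw (fun i => μ i ω) σ ρ (μd ω) σd
  measurable' := by
    have hg : Measurable fun p : Ω × (EuclideanSpace ℝ Fuel × ℝ) =>
        (WithLp.toLp 2 (fun i => μ i p.1) + p.2.1, μd p.1 + p.2.2) := by
      refine Measurable.prodMk (Measurable.add ?_ (by fun_prop)) (by fun_prop)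
      exact (WithLp.measurable_toLp 2 _).comp
        (measurable_pi_lambda _ fun i => (hμ i).comp measurable_fst)
    have h1 := (Measure.measurable_map _ hg).comp
      (Measurable.map_prodMk_left (α := Ω) (ν := jointLaw 0 σ ρ 0 σd))
    convert h1 using 1
    funext ω
    rw [jointLaw_eq_map, Function.comp_apply, Measure.map_map hg measurable_prodMk_left]
    rfl

theorem isMarkovKernel_jointKernel {Ω : Type*} [MeasurableSpace Ω] {μ : Fuel → Ω → ℝ} (hμ : ∀ i, Measurable (μ i))
    (σ : Fuel → ℝ) (ρ : ℝ) {μd : Ω → ℝ} (hμd : Measurable μd) (σd : ℝ) :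
    IsMarkovKernel (jointKernel hμ σ ρ hμd σd) :=
  ⟨fun ω => inferInstanceAs (IsProbabilityMeasure (jointLaw (fun i => μ i ω) σ ρ (μd ω) σd))⟩

/-- The logarithms of the fuel prices. -/
def logPrice {Ω : Type*} (S : Fuel → Ω → ℝ) (ω : Ω) : EuclideanSpace ℝ Fuel :=
  WithLp.toLp 2 fun i => Real.log (S i ω)

theorem measurable_logPrice {Ω : Type*} [MeasurableSpace Ω] {S : Fuel → Ω → ℝ}
    (hS : ∀ i, Measurable (S i)) : Measurable (logPrice S) :=
  (WithLp.measurable_toLp 2 _).comp (measurable_pi_lambda _ fun i => (hS i).log)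

theorem condExp_eq_integral_jointLaw {Ω : Type*} {m mΩ : MeasurableSpace Ω} (hm : m ≤ mΩ)
    (Q : Measure Ω) [IsProbabilityMeasure Q] {S : Fuel → Ω → ℝ} {X : Ω → ℝ}
    (hS : ∀ i, Measurable (S i)) (hX : Measurable X) {σ : Fuel → ℝ} {ρ σd : ℝ}
    {μ : Fuel → Ω → ℝ} (hμ : ∀ i, Measurable[m] (μ i)) {μd : Ω → ℝ} (hμd : Measurable[m] μd)
    (hS_law : HasCondLaw Q m (logPrice S) (fun ω => logLaw (fun i => μ i ω) σ ρ))
    (hX_law : HasCondLaw Q m X (fun ω => gaussianReal (μd ω) (Real.toNNReal (σd ^ 2))))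
    (hSX : CondIndependent Q m (fun ω i => S i ω) X)
    {f : EuclideanSpace ℝ Fuel × ℝ → ℝ} (hf : Measurable f)
    (hint : Integrable (fun ω => f (logPrice S ω, X ω)) Q) :
    Q[fun ω => f (logPrice S ω, X ω) | m]
      =ᵐ[Q] fun ω => ∫ z, f z ∂(jointLaw (fun i => μ i ω) σ ρ (μd ω) σd) := by
  have key := @condExp_comap_eq_integral Ω Ω (EuclideanSpace ℝ Fuel) ℝ mΩ m _ _ Q _ _ _ _ _
    id (measurable_id'' hm) (logPrice S) (measurable_logPrice hS) X hX
    (@jointKernel Ω m μ hμ σ ρ μd hμd σd) 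
    (@isMarkovKernel_jointKernel Ω m μ hμ σ ρ μd hμd σd) ?_ f hf hint
  · rwa [MeasurableSpace.comap_id] at key
  · intro A A' hA hA'
    rw [MeasurableSpace.comap_id]
    have hlog : Measurable fun s : Fuel → ℝ =>
        (WithLp.toLp 2 fun i => Real.log (s i) : EuclideanSpace ℝ Fuel) :=
      (WithLp.measurable_toLp 2 _).comp
        (measurable_pi_lambda _ fun i => (measurable_pi_apply i).log)
    have h1 := hSX _ A' (hlog hA) hA'
    have h2 := hS_law A hA
    have h3 := hX_law A' hA'
    filter_upwards [h1, h2, h3] with ω e1 e2 e3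
    refine Eq.trans e1 ((congrArg₂ (· * ·) e2 e3).trans ?_)
    exact (measureReal_prod_prod A A').symm

namespace BidCurves

variable {B : BidCurves} {h : ℝ}

theorem stack_le {s : Fuel → ℝ} (hs : ∀ i, 0 < s i) {ξ : ℝ} (hξ : ξ ≤ B.totalCap) :
    B.stack ξ s ≤ ∑ i, B.bid i (B.cap i) (s i) := by
  have hpos : ∀ i x, 0 < B.bid i x (s i) := fun i x => mul_pos (hs i) (Real.exp_pos _)
  have hle : ∀ i, B.bid i (B.cap i) (s i) ≤ ∑ i, B.bid i (B.cap i) (s i) := fun i =>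
    Finset.single_le_sum (f := fun i => B.bid i (B.cap i) (s i)) (fun j _ => (hpos j _).le)
      (Finset.mem_univ i)
  refine csSup_le ⟨_, Set.mem_insert _ _⟩ ?_
  rintro p (rfl | hp)
  · exact (min_le_left _ _).trans
      (((B.bid_strictMono .c (hs .c)).monotone (B.cap_pos .c).le).trans (hle .c))
  · by_contra! hlt
    refine absurd (show ∑ i, B.bidInv i p (s i) < ξ from hp) (not_lt.2 ?_)
    rw [Finset.sum_congr rfl fun i _ => B.bidInv_eq (hs i) (B.cap_pos i).le le_rfl
      (fun _ => (hle i).trans hlt.le) (fun h => absurd h (lt_irrefl _))]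
    exact hξ

theorem demand_le (x : ℝ) : B.demand x ≤ B.totalCap :=
  max_le totalCap_pos.le (min_le_left _ _)

theorem payoff_nonneg (s : Fuel → ℝ) (x : ℝ) : 0 ≤ B.payoff h s x := le_max_right _ _

theorem payoff_le (hh : 0 < h) {s : Fuel → ℝ} (hs : ∀ i, 0 < s i) (x : ℝ) :
    B.payoff h s x ≤ ∑ i, B.bid i (B.cap i) (s i) := by
  refine max_le ?_ (Finset.sum_nonneg fun i _ => (mul_pos (hs i) (Real.exp_pos _)).le)
  linarith [stack_le hs (B.demand_le x), mul_pos hh (hs .c)]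

theorem measurable_coalShare :
    Measurable fun z : EuclideanSpace ℝ Fuel × ℝ => B.coalShare z.1 z.2 := by
  unfold coalShare
  fun_prop

theorem measurable_payoff_expPrice (hh : 0 < h) (h0 : 0 ≤ B.xiH h) (hc : B.xiH h ≤ B.cap .c) :
    Measurable fun z : EuclideanSpace ℝ Fuel × ℝ => B.payoff h (expPrice z.1) z.2 := by
  let f : ℝ → ℝ := fun x => if x < B.totalCap then x else B.totalCap + 1
  have hf : Measurable f := Measurable.ite measurableSet_Iio measurable_id measurable_const
  have hdem : ∀ x, B.demand x = B.demand (f x) := fun x => by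
    by_cases hx : x < B.totalCap
    · simp only [f, if_pos hx]
    · simp only [f, if_neg hx, demand]
      rw [min_eq_left (not_lt.1 hx), min_eq_left (by linarith)]
  have hne : ∀ x, f x ≠ B.totalCap := fun x => by
    by_cases hx : x < B.totalCap
    · simpa only [f, if_pos hx] using hx.ne
    · simp [f, if_neg hx]
  suffices key : Measurable fun z : EuclideanSpace ℝ Fuel × ℝ =>
      B.payoff h (expPrice z.1) (f z.2) by
    have he : ∀ z : EuclideanSpace ℝ Fuel × ℝ,
        B.payoff h (expPrice z.1) z.2 = B.payoff h (expPrice z.1) (f z.2) := fun z => by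
      rw [payoff, hdem, payoff]
    simpa only [he] using key
  have hm : ∀ z : EuclideanSpace ℝ Fuel × ℝ, B.payoff h (expPrice z.1) (f z.2) = _ :=
    fun z => payoff_expPrice hh h0 hc (hne z.2)
  simp_rw [hm]
  have hz : Measurable fun z : EuclideanSpace ℝ Fuel × ℝ => f z.2 := hf.comp measurable_snd
  have hs : Measurable fun z : EuclideanSpace ℝ Fuel × ℝ => B.coalShare z.1 (f z.2) :=
    measurable_coalShare.comp (measurable_fst.prodMk hz)
  have hn : ∀ {n : ℕ} (a : Matrix (Fin 2) (Fin n) ℝ),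
      Measurable fun z : EuclideanSpace ℝ Fuel × ℝ => netCount a (f z.2) :=
    fun a => (measurable_netCount a).comp hz
  have hi : ∀ {u v : EuclideanSpace ℝ Fuel × ℝ → ℝ}, Measurable u → Measurable v →
      Measurable fun z => ind (u z ≤ v z) := fun hu hv => measurable_ind (measurableSet_le hu hv)
  have h1 := hi hz hs
  have h2 := hi hs (hz.sub_const (B.cap .g))
  have h3 := hi (measurable_const (a := B.cap .c)) hs
  have h4 := hi (measurable_const (a := B.xiH h)) hs
  have h5 := hi (measurable_const (a := B.totalCap)) hz
  have h6 : ∀ a : ℝ, Measurable fun z : EuclideanSpace ℝ Fuel × ℝ => ind (f z.2 ≤ a) :=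
    fun a => hi hz measurable_const
  have h7 : Measurable fun z : EuclideanSpace ℝ Fuel × ℝ => ind (z.1 .g + B.k .g
      + B.m .g * B.cap .g ≤ z.1 .c + B.k .c + B.m .c * B.cap .c) := hi (by fun_prop) (by fun_prop)
  fun_prop

theorem xiH_nonneg (hh : Real.exp (B.k .c) ≤ h) : 0 ≤ B.xiH h := by
  have := (Real.le_log_iff_exp_le ((Real.exp_pos _).trans_le hh)).2 hh
  exact div_nonneg (by linarith) (B.m_pos .c).le

theorem xiH_le (hh : 0 < h) (hh' : h ≤ Real.exp (B.k .c + B.m .c * B.cap .c)) :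
    B.xiH h ≤ B.cap .c := by
  have := (Real.log_le_iff_le_exp hh).2 hh'
  rw [xiH, div_le_iff₀ (B.m_pos .c)]
  linarith

end BidCurves

section Market

variable {Ω : Type*} {m mΩ : MeasurableSpace Ω} {Q : Measure Ω} {S : Fuel → Ω → ℝ} {X : Ω → ℝ}

theorem expPrice_logPrice_ae_eq (hS : ∀ i, ∀ᵐ ω ∂Q, 0 < S i ω) :
    ∀ᵐ ω ∂Q, (∀ i, 0 < S i ω) ∧ expPrice (logPrice S ω) = fun i => S i ω := by
  filter_upwards [ae_all_iff.2 hS] with ω hω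
  exact ⟨hω, funext fun i => Real.exp_log (hω i)⟩

theorem payoff_logPrice_ae_eq (B : BidCurves) (h : ℝ) (hS : ∀ i, ∀ᵐ ω ∂Q, 0 < S i ω) :
    (fun ω => B.payoff h (fun i => S i ω) (X ω))
      =ᵐ[Q] fun ω => B.payoff h (expPrice (logPrice S ω)) (X ω) := by
  filter_upwards [expPrice_logPrice_ae_eq hS] with ω hω
  rw [hω.2]

theorem integrable_payoff {B : BidCurves} {h : ℝ} (hh : 0 < h) (h0 : 0 ≤ B.xiH h)
    (hc : B.xiH h ≤ B.cap .c) (hS : ∀ i, Measurable (S i)) (hX : Measurable X)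
    (hS_pos : ∀ i, ∀ᵐ ω ∂Q, 0 < S i ω) (hS_int : ∀ i, Integrable (S i) Q) :
    Integrable (fun ω => B.payoff h (fun i => S i ω) (X ω)) Q := by
  have hmeas : Measurable fun ω => B.payoff h (expPrice (logPrice S ω)) (X ω) :=
    Measurable.comp (f := fun ω => (logPrice S ω, X ω))
      (BidCurves.measurable_payoff_expPrice hh h0 hc) ((measurable_logPrice hS).prodMk hX)
  have hbid : Integrable (fun ω => ∑ i, B.bid i (B.cap i) (S i ω)) Q :=
    integrable_finsetSum _ fun i _ => (hS_int i).mul_const _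
  refine hbid.mono' (hmeas.aestronglyMeasurable.congr (payoff_logPrice_ae_eq B h hS_pos).symm) ?_
  filter_upwards [expPrice_logPrice_ae_eq hS_pos] with ω hω
  rw [Real.norm_of_nonneg (B.payoff_nonneg _ _)]
  exact BidCurves.payoff_le hh hω.1 _

theorem forwardPrice_ae_eq [IsProbabilityMeasure Q] (hm : m ≤ mΩ)
    (hS : ∀ i, Measurable (S i)) (hX : Measurable X)
    (hS_pos : ∀ i, ∀ᵐ ω ∂Q, 0 < S i ω) (hS_int : ∀ i, Integrable (S i) Q)
    {σ : Fuel → ℝ} {ρ σd : ℝ} (hρ : |ρ| ≤ 1)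
    {μ : Fuel → Ω → ℝ} (hμ : ∀ i, Measurable[m] (μ i)) {μd : Ω → ℝ} (hμd : Measurable[m] μd)
    (hS_law : HasCondLaw Q m (logPrice S) (fun ω => logLaw (fun i => μ i ω) σ ρ))
    (hX_law : HasCondLaw Q m X (fun ω => gaussianReal (μd ω) (Real.toNNReal (σd ^ 2))))
    (hSX : CondIndependent Q m (fun ω i => S i ω) X) (i : Fuel) :
    forwardPrice Q m (S i) =ᵐ[Q] fun ω => lognormalMean (fun j => μ j ω) σ i := by
  have hae : S i =ᵐ[Q] fun ω => Real.exp (logPrice S ω i) := by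
    filter_upwards [hS_pos i] with ω hω
    exact (Real.exp_log hω).symm
  have h1 := condExp_eq_integral_jointLaw hm Q hS hX hμ hμd hS_law hX_law hSX
    (f := fun z => Real.exp (z.1 i)) (by fun_prop) ((hS_int i).congr hae)
  refine (condExp_congr_ae hae).trans (h1.trans (.of_forall fun ω => ?_))
  cases i
  · have h2 := integral_exp_jointLaw (σ := σ) hρ (fun j => μ j ω) (μd ω) σd 1 0 0
    simpa [BidCurves.exp_logMoment_coal] using h2
  · have h2 := integral_exp_jointLaw (σ := σ) hρ (fun j => μ j ω) (μd ω) σd 0 1 0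
    simpa [BidCurves.exp_logMoment_gas] using h2

end Market

end DarkSpread

end

theorem mainTheorem4 {Ω : Type*} {mΩ : MeasurableSpace Ω}
    (Q : Measure Ω) [IsProbabilityMeasure Q] (ℱ : Filtration ℝ≥0 mΩ)
    (T t : ℝ≥0) (htT : t ≤ T) (r : ℝ)
    (B : DarkSpread.BidCurves)
    (h : ℝ) (hh_lower : Real.exp (B.k .c) ≤ h)
    (hh_upper : h ≤ Real.exp (B.k .c + B.m .c * B.cap .c))
    -- fuel prices and untruncated demand at maturity
    (S : DarkSpread.Fuel → Ω → ℝ) (X : Ω → ℝ)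
    (hS_meas : ∀ i, Measurable (S i)) (hX_meas : Measurable X)
    (hS_pos : ∀ i, ∀ᵐ ω ∂Q, 0 < S i ω) (hS_int : ∀ i, Integrable (S i) Q)
    -- parameters of the laws given the information at time t
    (σ : DarkSpread.Fuel → ℝ) (hσ : ∀ i, 0 ≤ σ i) (ρ : ℝ) (hρ : |ρ| ≤ 1)
    (hvol : 0 < DarkSpread.volSq σ ρ) (σd : ℝ) (hσd : 0 < σd)
    (μ : DarkSpread.Fuel → Ω → ℝ) (hμ : ∀ i, Measurable[ℱ t] (μ i))
    (μd : Ω → ℝ) (hμd : Measurable[ℱ t] μd)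
    (hS_law : DarkSpread.HasCondLaw Q (ℱ t)
      (fun ω => (WithLp.toLp 2 (fun i => Real.log (S i ω)) : EuclideanSpace ℝ DarkSpread.Fuel))
      (fun ω => DarkSpread.logLaw (fun i => μ i ω) σ ρ))
    (hX_law : DarkSpread.HasCondLaw Q (ℱ t) X
      (fun ω => gaussianReal (μd ω) (Real.toNNReal (σd ^ 2))))
    (hSX : DarkSpread.CondIndependent Q (ℱ t) (fun ω i => S i ω) X) :
    Integrable (fun ω => B.payoff h (fun i => S i ω) (X ω)) Q ∧
      DarkSpread.spreadPrice Q ℱ r t T B h S X =ᵐ[Q] fun ω =>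
        Real.exp (-r * ((T : ℝ) - t)) *
          B.closedForm h σ ρ (μd ω) σd
            (fun i => DarkSpread.forwardPrice Q (ℱ t) (S i) ω) := by
  have hh : 0 < h := (Real.exp_pos _).trans_le hh_lower
  have h0 := DarkSpread.BidCurves.xiH_nonneg hh_lower
  have hc := DarkSpread.BidCurves.xiH_le hh hh_upper
  have hint := DarkSpread.integrable_payoff hh h0 hc hS_meas hX_meas hS_pos hS_int
  refine ⟨hint, ?_⟩
  have hae := DarkSpread.payoff_logPrice_ae_eq (X := X) B h hS_pos
  have h1 := DarkSpread.condExp_eq_integral_jointLaw (ℱ.le t) Q hS_meas hX_meas hμ hμd hS_law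
    hX_law hSX (DarkSpread.BidCurves.measurable_payoff_expPrice hh h0 hc) (hint.congr hae)
  have h2 := ae_all_iff.2 (DarkSpread.forwardPrice_ae_eq (ℱ.le t) hS_meas hX_meas hS_pos hS_int
    hρ hμ hμd hS_law hX_law hSX)
  filter_upwards [(condExp_congr_ae hae).trans h1, h2] with ω e1 e2
  rw [DarkSpread.spreadPrice, e1, DarkSpread.BidCurves.integral_payoff hρ hσd hvol hh h0 hc,
    funext e2]
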